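/- Let $A$ be a fixed right-angled Artin group, given by a finite simple graph $\Gamma$ with vertices $a_1,\dots,a_N$: the group $A$ is generated by $a_1,\dots,a_N$, subject to the relations $a_ia_j=a_ja_i$ for all pairs $a_i,a_j$ that are not joined by an edge of $\Gamma$ (so edges join non-commuting generators). For a word $w$ in the letters $a_i^{\pm1}$ let $[w]\in A$ be the element it represents, and let $\Delta(w)$ be the full subgraph of $\Gamma$ on the generators occurring in $w$. A word is *reduced* if it has no subword $a_i^{\pm1}xa_i^{\mp1}$ in which all letters of $x$ commute with $a_i$; it is *cyclically reduced* if it is reduced and not of the form $x_1a_i^{\pm1}x_2a_i^{\mp1}x_3$ in which all letters of $x_1$ and $x_3$ commute with $a_i$. A nontrivial reduced word $w$ is *non-split* if $\Delta(w)$ is connected. A reduced word is *normal* if for each of its nonempty suffixes $v$ the index of the first letter of $v$ is at least the index of the first letter of any reduced word representing $[v]$. A cyclically reduced word is a *cyclic normal form* if it and all its cyclic permutations are normal. There is an algorithm with the following properties. Its input is a cyclically reduced word $w$, given as a product $w=w_1\cdots w_k$ ($k\ge 0$) of non-split words $w_1,\dots,w_k$ in cyclic normal form, one for each connected component of $\Delta(w)$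 (that is, for $i\ne j$ the generators occurring in $w_i$ are different from, and commute with, those occurring in $w_j$). It runs on a random access machine (with addition and subtraction at unit cost) in time at most $C(\ell+1)$, where $\ell$ is the length of $w$ and the constant $C$ and the program depend only on $\Gamma$; moreover, the numbers held in its registers never exceed $C(\ell+1)$. Its output is the canonical generating set of the centralizer of $[w]$ in $A$, which consists of 1. words $z_1,\dots,z_k$, where $z_i$ is the minimal root of $w_i$: the word $z_i$ is cyclically reduced, $[z_i]$ generates the unique maximal infinite cyclic subgroup of $A$ containing $[w_i]$, and there is an equality of words $w_i=z_i^{r_i}$, where $r_i$ is the largest integer $r$ for which the word $w_i$ is the $r$-th power of a word; 2. the generators among $a_1,\dots,a_N$ that commute with all generators occurring in $w$. The elements represented by this output generate the centralizer of $[w]$ in $A$. -/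

import Mathlib

/-! ### Right-angled Artin groups, words and normal forms -/

namespace RAAG

/-- Words in the letters `a_i^{±1}`; the letter `a_i` is `(i, true)` and `a_i⁻¹` is `(i, false)`. -/
abbrev Word (N : ℕ) : Type := List (Fin N × Bool)

/-- Two generators commute exactly when the corresponding vertices are not joined by an edge. -/
def GenCommute {N : ℕ} (Γ : SimpleGraph (Fin N)) (a b : Fin N) : Prop := ¬ Γ.Adj a b

/-- The defining relators: commutators of the pairs of commuting generators. -/
def relators {N : ℕ} (Γ : SimpleGraph (Fin N)) : Set (FreeGroup (Fin N)) :=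
  {r | ∃ a b : Fin N, GenCommute Γ a b ∧ 
    r = FreeGroup.of a * FreeGroup.of b * (FreeGroup.of a)⁻¹ * (FreeGroup.of b)⁻¹}

/-- The right-angled Artin group with defining graph `Γ` (edges join non-commuting generators). -/
abbrev RAAGroup {N : ℕ} (Γ : SimpleGraph (Fin N)) : Type := PresentedGroup (relators Γ)

/-- The generator `a_i` as an element of the group. -/
def gen {N : ℕ} (Γ : SimpleGraph (Fin N)) (a : Fin N) : RAAGroup Γ := PresentedGroup.of a

/-- The element `[w]` of the group represented by the word `w`. -/
def elt {N : ℕ} (Γ : SimpleGraph (Fin N)) (w : Word N) : RAAGroup Γ :=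
  PresentedGroup.mk (relators Γ) (FreeGroup.mk w)

/-- A word is reduced if it has no subword `a^{±1} x a^{∓1}` in which all letters of `x`
commute with `a`. -/
def Reduced {N : ℕ} (Γ : SimpleGraph (Fin N)) (w : Word N) : Prop :=
  ¬ ∃ (u x v : Word N) (a : Fin N) (ε : Bool),
    w = u ++ [(a, ε)] ++ x ++ [(a, !ε)] ++ v ∧ ∀ l ∈ x, GenCommute Γ a l.1

/-- A word is cyclically reduced if it is reduced and not of the form `x₁ a^{±1} x₂ a^{∓1} x₃`
in which all letters of `x₁` and `x₃` commute with `a`. -/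
def CyclicallyReduced {N : ℕ} (Γ : SimpleGraph (Fin N)) (w : Word N) : Prop :=
  Reduced Γ w ∧ ¬ ∃ (x₁ x₂ x₃ : Word N) (a : Fin N) (ε : Bool),
    w = x₁ ++ [(a, ε)] ++ x₂ ++ [(a, !ε)] ++ x₃ ∧
      (∀ l ∈ x₁, GenCommute Γ a l.1) ∧ ∀ l ∈ x₃, GenCommute Γ a l.1

/-- The (reduced) word `w` is trivial, or the index of its first letter is at least the index of
the first letter of every reduced word that represents the same element. -/
def InitiallyNormal {N : ℕ} (Γ : SimpleGraph (Fin N)) (w : Word N) : Prop :=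
  ∀ (l : Fin N × Bool) (t : Word N), w = l :: t →
    ∀ (l' : Fin N × Bool) (t' : Word N), Reduced Γ (l' :: t') →
      elt Γ (l' :: t') = elt Γ w → l'.1 ≤ l.1

/-- A reduced word is normal if all its suffixes are initially normal. -/
def Normal {N : ℕ} (Γ : SimpleGraph (Fin N)) (w : Word N) : Prop :=
  Reduced Γ w ∧ ∀ v : Word N, v <:+ w → InitiallyNormal Γ v

/-- A cyclic normal form: a cyclically reduced word all of whose cyclic permutations
(including the word itself) are normal. -/
def CyclicNormalForm {N : ℕ} (Γ : SimpleGraph (Fin N)) (w : Word N) : Prop :=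
  CyclicallyReduced Γ w ∧ ∀ v : Word N, v ~r w → Normal Γ v

/-- The set of generators occurring in `w`, with either exponent. -/
def support {N : ℕ} (w : Word N) : Set (Fin N) := {a | ∃ l ∈ w, l.1 = a}

/-- A non-trivial reduced word is non-split if the full subgraph on its support is connected. -/
def NonSplit {N : ℕ} (Γ : SimpleGraph (Fin N)) (w : Word N) : Prop :=
  w ≠ [] ∧ Reduced Γ w ∧ (Γ.induce (support w)).Connected

/-- `ws = [w₁, …, w_k]` is a decomposition of the cyclically reduced word `w₁ ⋯ w_k` into
non-split cyclic normal forms, one for each connected component of the full subgraph on the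
support of `w₁ ⋯ w_k`: there are no edges between the supports of distinct factors, which
are disjoint, and the support of each factor is connected. -/
structure IsNonSplitDecomposition {N : ℕ} (Γ : SimpleGraph (Fin N)) (ws : List (Word N)) :
    Prop where
  cyclicallyReduced : CyclicallyReduced Γ ws.flatten
  cyclicNormalForm : ∀ w ∈ ws, CyclicNormalForm Γ w
  nonSplit : ∀ w ∈ ws, NonSplit Γ w
  separated : ws.Pairwise fun u v =>
    ∀ a ∈ support u, ∀ b ∈ support v, a ≠ b ∧ GenCommute Γ a b

/-! ### The canonical generating set of the centralizer -/

/-- The word `z^r`. -/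
def wordPow {N : ℕ} (z : Word N) (r : ℕ) : Word N := (List.replicate r z).flatten

/-- `K` is an infinite cyclic subgroup containing `g`. -/
def IsInfiniteCyclicThrough {G : Type} [Group G] (g : G) (K : Subgroup G) : Prop :=
  IsCyclic K ∧ Infinite K ∧ g ∈ K

/-- The cyclically reduced word `z` is the minimal root of the word `w`: the element `[z]`
generates the unique maximal infinite cyclic subgroup containing `[w]`, and, as a word, `w` is a
power `z^r`, where `r` is the largest exponent for which `w` is the `r`-th power of a word. -/
structure IsMinimalRoot {N : ℕ} (Γ : SimpleGraph (Fin N)) (w z : Word N) : Prop where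
  cyclicallyReduced : CyclicallyReduced Γ z
  maximal : Maximal (IsInfiniteCyclicThrough (elt Γ w)) (Subgroup.zpowers (elt Γ z))
  unique : ∀ K : Subgroup (RAAGroup Γ), Maximal (IsInfiniteCyclicThrough (elt Γ w)) K →
    K = Subgroup.zpowers (elt Γ z)
  power : ∃ r : ℕ, w = wordPow z r ∧ ∀ (z' : Word N) (r' : ℕ), w = wordPow z' r' → r' ≤ r

/-- The list `out` of words enumerates the canonical generating set for the centralizer of
`w₁ ⋯ w_k`: first the minimal roots of `w₁, …, w_k`, then, each once, the generators that commute
with all generators occurring in `w₁ ⋯ w_k`. -/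
def IsCanonicalGeneratingList {N : ℕ} (Γ : SimpleGraph (Fin N)) (ws out : List (Word N)) : Prop :=
  ∃ (zs : List (Word N)) (gs : List (Fin N)),
    out = zs ++ gs.map (fun a => [(a, true)]) ∧
    List.Forall₂ (IsMinimalRoot Γ) ws zs ∧
    gs.Nodup ∧
    ∀ a : Fin N, a ∈ gs ↔ ∀ b ∈ support ws.flatten, Commute (gen Γ a) (gen Γ b)

/-- Letters are coded by numbers `≥ 2`. -/
def letterCode {N : ℕ} (l : Fin N × Bool) : ℕ := 2 * (l.1 : ℕ) + (if l.2 then 2 else 3)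

/-- A list of words is coded over a finite alphabet: every word is followed by the separator `1`,
and the list is followed by the end mark `0`. -/
def encode {N : ℕ} (ws : List (Word N)) : List ℕ :=
  ws.flatMap (fun w => w.map letterCode ++ [1]) ++ [0]

end RAAG

/-! ### Random access machines

Registers `0, 1, 2, …` hold natural numbers. There is a read-only input tape and a write-only
output tape. Every instruction costs one unit of time. -/

namespace RAM

/-- A constant, the content of register `r`, or the content of the register whose address is
in register `r`. -/
inductive Source where
  | imm (c : ℕ)
  | reg (r : ℕ)
  | ind (r : ℕ)

/-- Register `r`, or the register whose address is in register `r`. -/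
inductive Target where
  | reg (r : ℕ)
  | ind (r : ℕ)

inductive Instr where
  /-- copy a value -/
  | mov (d : Target) (x : Source)
  /-- addition -/
  | add (d : Target) (x y : Source)
  /-- truncated subtraction `max (x - y) 0` -/
  | sub (d : Target) (x y : Source)
  /-- jump to instruction `k` if the value is zero -/
  | jz (x : Source) (k : ℕ)
  /-- read the next input symbol (`0` if the input is exhausted) -/
  | read (d : Target)
  /-- append a value to the output -/
  | write (x : Source)
  | halt

/-- A program is a finite list of instructions, numbered from `0`. -/
abbrev Program : Type := List Instr

structure Config where
  pc : ℕ
  mem : ℕ → ℕ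
  input : List ℕ
  output : List ℕ

def Config.val (c : Config) : Source → ℕ
  | .imm n => n
  | .reg r => c.mem r
  | .ind r => c.mem (c.mem r)

def Config.addr (c : Config) : Target → ℕ
  | .reg r => r
  | .ind r => c.mem r

/-- Store `n` at `d` and move on to the next instruction. -/
def Config.put (c : Config) (d : Target) (n : ℕ) : Config :=
  { c with pc := c.pc + 1, mem := Function.update c.mem (c.addr d) n }

/-- The effect of one instruction; `none` means that the machine stops. -/
def exec (c : Config) : Instr → Option Config
  | .mov d x => some (c.put d (c.val x))
  | .add d x y => some (c.put d (c.val x + c.val y))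
  | .sub d x y => some (c.put d (c.val x - c.val y))
  | .jz x k => some { c with pc := if c.val x = 0 then k else c.pc + 1 }
  | .read d => some { c.put d (c.input.headD 0) with input := c.input.tail }
  | .write x => some { c with pc := c.pc + 1, output := c.output ++ [c.val x] }
  | .halt => none

/-- One step of the program; the machine also stops if there is no instruction to execute. -/
def step (P : Program) (c : Config) : Option Config := P[c.pc]?.bind (exec c)

/-- The initial configuration: all registers are zero. -/
def init (input : List ℕ) : Config := ⟨0, fun _ => 0, input, []⟩

/-- `Run P t c d`: the program leads from `c` to `d` in exactly `t` steps. -/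
def Run (P : Program) : ℕ → Config → Config → Prop
  | 0, c, d => c = d
  | t + 1, c, d => ∃ c', step P c = some c' ∧ Run P t c' d

/-- On the given input the program stops after at most `T` steps with the given output, and during
the computation no register ever holds a number larger than `B`. -/
def ComputesWithin (P : Program) (input output : List ℕ) (T B : ℕ) : Prop :=
  (∃ t ≤ T, ∃ d : Config, Run P t (init input) d ∧ step P d = none ∧ d.output = output) ∧
  ∀ (t : ℕ) (c : Config), Run P t (init input) c → ∀ r : ℕ, c.mem r ≤ B

end RAM

/-!
A letter acts on reduced words by cancelling against a first letter when it can and by being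
prepended otherwise. Up to trace equivalence (exchange of consecutive independent letters) this is
an action of `A`, so two reduced words representing the same element are trace equivalent.

Let `g` commute with `[w]`, where `w` is cyclically reduced. After multiplication by a power of
`[w]`, the element `g` is represented by a word `x` with `wx` reduced; then `xw` is reduced too, and
`wx` and `xw` are trace equivalent. Trace equivalence preserves the subwords on the letters of two
non-commuting generators, so comparing these subwords shows that a generator of `x` not occurring in
`w` commutes with all of `w`. The rest of `x` splits into words `x_i` on the generators of the
`w_i`. If `w_i` is rotated so as to start with its smallest generator, then `w_i` followed by the
normal form of `x_i` and the same words in the other order are both normal, so that they are equal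
as words and `x_i` represents a power of the root.

In particular, any `g` with `g^s = [w_i]` is a power of `[z_i]` times an element `c` that commutes
with `z_i` and is fixed by the endomorphism killing the generators of `w_i`. This endomorphism gives
`c^s = 1`, hence `c = 1`, since `A` is torsion-free, so that the root generates the unique
maximal infinite cyclic subgroup.

The root of `w` has length `n - b` when `n - b` divides `n`, and length `n` otherwise, where
`n = |w|` and `b` is the length of the longest proper border of `w`. The machine computes the
borders of all prefixes by the failure function of Knuth, Morris and Pratt, and tests divisibility
by repeated subtraction.
-/

namespace RAAG

variable {N : ℕ} {Γ : SimpleGraph (Fin N)}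

/-! ### Commutation of letters and trace equivalence of words -/

/-- The inverse letter. -/
def bar (l : Fin N × Bool) : Fin N × Bool := (l.1, !l.2)

@[simp] theorem bar_bar (l : Fin N × Bool) : bar (bar l) = l := by
  simp [bar]

theorem bar_ne (l : Fin N × Bool) : bar l ≠ l := by
  rcases l with ⟨a, _ | _⟩ <;> simp [bar]

/-- Letters with distinct commuting generators. -/
def Indep (Γ : SimpleGraph (Fin N)) (l m : Fin N × Bool) : Prop :=
  l.1 ≠ m.1 ∧ ¬ Γ.Adj l.1 m.1

theorem Indep.symm {l m : Fin N × Bool} (h : Indep Γ l m) : Indep Γ m l :=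
  ⟨h.1.symm, fun h' => h.2 h'.symm⟩

theorem not_indep_self (l : Fin N × Bool) : ¬ Indep Γ l l := fun h => h.1 rfl

/-- Exchange of two consecutive independent letters. -/
def SwapStep (Γ : SimpleGraph (Fin N)) (u v : Word N) : Prop :=
  ∃ p q l m, Indep Γ l m ∧ u = p ++ l :: m :: q ∧ v = p ++ m :: l :: q

/-- Trace equivalence: the words differ by exchanges of consecutive independent letters. -/
def Swap (Γ : SimpleGraph (Fin N)) : Word N → Word N → Prop := Relation.ReflTransGen (SwapStep Γ)

theorem SwapStep.symm {u v : Word N} (h : SwapStep Γ u v) : SwapStep Γ v u := by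
  obtain ⟨p, q, l, m, h, rfl, rfl⟩ := h
  exact ⟨p, q, m, l, h.symm, rfl, rfl⟩

theorem Swap.refl (u : Word N) : Swap Γ u u := Relation.ReflTransGen.refl

theorem Swap.trans {u v w : Word N} (h : Swap Γ u v) (h' : Swap Γ v w) : Swap Γ u w :=
  Relation.ReflTransGen.trans h h'

theorem Swap.symm {u v : Word N} (h : Swap Γ u v) : Swap Γ v u := by
  induction h with
  | refl => exact .refl _
  | tail _ h ih => exact .trans (.single h.symm) ih

theorem Swap.invariant {α : Sort*} (f : Word N → α)
    (hf : ∀ (p q : Word N) l m, Indep Γ l m → f (p ++ l :: m :: q) = f (p ++ m :: l :: q))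
    {u v : Word N} (h : Swap Γ u v) : f u = f v := by
  induction h with
  | refl => rfl
  | tail _ h ih =>
    obtain ⟨p, q, l, m, h, rfl, rfl⟩ := h
    exact ih.trans (hf p q l m h)

theorem Swap.map (f : Word N → Word N)
    (hf : ∀ (p q : Word N) l m, Indep Γ l m → Swap Γ (f (p ++ l :: m :: q)) (f (p ++ m :: l :: q)))
    {u v : Word N} (h : Swap Γ u v) : Swap Γ (f u) (f v) := by
  induction h with
  | refl => exact .refl _
  | tail _ h ih =>
    obtain ⟨p, q, l, m, h, rfl, rfl⟩ := h
    exact ih.trans (hf p q l m h)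

theorem Swap.of_indep {l m : Fin N × Bool} (h : Indep Γ l m) (p q : Word N) :
    Swap Γ (p ++ l :: m :: q) (p ++ m :: l :: q) := .single ⟨p, q, l, m, h, rfl, rfl⟩

theorem Swap.append_left {u v : Word N} (p : Word N) (h : Swap Γ u v) :
    Swap Γ (p ++ u) (p ++ v) := by
  refine h.map _ fun p' q l m h => ?_
  simpa using Swap.of_indep h (p ++ p') q

theorem Swap.append_right {u v : Word N} (p : Word N) (h : Swap Γ u v) :
    Swap Γ (u ++ p) (v ++ p) := by
  refine h.map (· ++ p) fun p' q l m h => ?_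
  simpa using Swap.of_indep h p' (q ++ p)

theorem Swap.append {u v u' v' : Word N} (h : Swap Γ u v) (h' : Swap Γ u' v') :
    Swap Γ (u ++ u') (v ++ v') := (h.append_right _).trans (h'.append_left _)

theorem Swap.cons {u v : Word N} (l : Fin N × Bool) (h : Swap Γ u v) :
    Swap Γ (l :: u) (l :: v) := h.append_left [l]

theorem Swap.perm {u v : Word N} (h : Swap Γ u v) : u.Perm v := by
  induction h with
  | refl => exact .refl _
  | tail _ h ih =>
    obtain ⟨p, q, l, m, -, rfl, rfl⟩ := h
    exact ih.trans ((List.Perm.swap _ _ _).append_left p)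

theorem Swap.filter {u v : Word N} (f : Fin N × Bool → Bool) (h : Swap Γ u v) :
    Swap Γ (u.filter f) (v.filter f) := by
  refine h.map _ fun p q l m h => ?_
  simp only [List.filter_append, List.filter_cons]
  split_ifs
  · exact Swap.of_indep h _ _
  all_goals exact .refl _

theorem Swap.erase {u v : Word N} (b : Fin N × Bool) (h : Swap Γ u v) :
    Swap Γ (u.erase b) (v.erase b) := by
  refine h.map (fun u => u.erase b) fun p q l m h => ?_
  simp only [List.erase_append]
  split_ifs
  · exact Swap.of_indep h _ _
  · have hlm : l ≠ m := fun e => h.1 (by rw [e])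
    simp only [List.erase_cons, beq_iff_eq]
    split_ifs with h1 h2
    · exact absurd (h1.trans h2.symm) hlm
    · exact .refl _
    · exact .refl _
    · exact Swap.of_indep h _ _

theorem swap_append_singleton (b : Fin N × Bool) (p : Word N) (h : ∀ x ∈ p, Indep Γ x b) :
    Swap Γ (p ++ [b]) (b :: p) := by
  induction p with
  | nil => exact .refl _
  | cons x p ih =>
    have h1 : Swap Γ (x :: p ++ [b]) (x :: b :: p) := (ih fun y hy => h y (by simp [hy])).cons x
    exact h1.trans (Swap.of_indep (h x (by simp)) [] p)

/-! ### First letters -/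

/-- The letter `b` is a first letter of some word trace equivalent to the given one. -/
def First (Γ : SimpleGraph (Fin N)) (b : Fin N × Bool) : Word N → Prop
  | [] => False
  | h :: t => h = b ∨ (Indep Γ h b ∧ First Γ b t)

@[simp] theorem first_nil (b : Fin N × Bool) : ¬ First Γ b [] := id

theorem first_cons {b h : Fin N × Bool} {t : Word N} :
    First Γ b (h :: t) ↔ h = b ∨ (Indep Γ h b ∧ First Γ b t) := Iff.rfl

theorem first_cons_of_indep {b h : Fin N × Bool} {t : Word N} (hb : Indep Γ h b) :
    First Γ b (h :: t) ↔ First Γ b t := by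
  rw [first_cons]
  constructor
  · rintro (rfl | h)
    · exact absurd hb (not_indep_self _)
    · exact h.2
  · exact fun h => .inr ⟨hb, h⟩

theorem first_iff {b : Fin N × Bool} {u : Word N} :
    First Γ b u ↔ ∃ p q, u = p ++ b :: q ∧ ∀ x ∈ p, Indep Γ x b := by
  induction u with
  | nil => simp
  | cons h t ih =>
    rw [first_cons, ih]
    constructor
    · rintro (rfl | ⟨hb, p, q, rfl, hp⟩)
      · exact ⟨[], t, rfl, by simp⟩
      · exact ⟨h :: p, q, rfl, List.forall_mem_cons.2 ⟨hb, hp⟩⟩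
    · rintro ⟨p, q, e, hp⟩
      cases p with
      | nil => left; simpa using (List.cons.inj e).1
      | cons x p =>
        obtain ⟨rfl, rfl⟩ := List.cons.inj e
        exact .inr ⟨hp h (by simp), p, q, rfl, fun y hy => hp y (by simp [hy])⟩

theorem First.mem {b : Fin N × Bool} {u : Word N} (h : First Γ b u) : b ∈ u := by
  obtain ⟨p, q, rfl, -⟩ := first_iff.1 h
  simp

theorem First.append {b : Fin N × Bool} {u : Word N} (h : First Γ b u) (v : Word N) :
    First Γ b (u ++ v) := by
  obtain ⟨p, q, rfl, hp⟩ := first_iff.1 h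
  exact first_iff.2 ⟨p, q ++ v, by simp, hp⟩

theorem First.of_append {b : Fin N × Bool} {u v : Word N} (h : First Γ b (u ++ v))
    (hb : ∃ x ∈ u, x.1 = b.1) : First Γ b u := by
  induction u with
  | nil => simp at hb
  | cons x u ih =>
    rcases h with rfl | ⟨hx, h⟩
    · exact .inl rfl
    · refine .inr ⟨hx, ih h ?_⟩
      obtain ⟨y, hy, e⟩ := hb
      rcases List.mem_cons.1 hy with rfl | hy
      · exact absurd e hx.1
      · exact ⟨y, hy, e⟩

theorem Swap.first_iff {u v : Word N} (b : Fin N × Bool) (h : Swap Γ u v) :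
    First Γ b u ↔ First Γ b v := by
  refine iff_of_eq (h.invariant (First Γ b) fun p q l m h => ?_)
  induction p with
  | nil =>
    simp only [List.nil_append, eq_iff_iff, first_cons]
    constructor
    · rintro (rfl | ⟨h1, rfl | ⟨h2, h3⟩⟩)
      · exact .inr ⟨h.symm, .inl rfl⟩
      · exact .inl rfl
      · exact .inr ⟨h2, .inr ⟨h1, h3⟩⟩
    · rintro (rfl | ⟨h1, rfl | ⟨h2, h3⟩⟩)
      · exact .inr ⟨h, .inl rfl⟩
      · exact .inl rfl
      · exact .inr ⟨h2, .inr ⟨h1, h3⟩⟩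
  | cons x p ih =>
    simp only [List.cons_append, eq_iff_iff, first_cons] at ih ⊢
    rw [ih]

theorem First.swap_cons_erase {b : Fin N × Bool} {u : Word N} (h : First Γ b u) :
    Swap Γ u (b :: u.erase b) := by
  induction u with
  | nil => exact h.elim
  | cons x u ih =>
    rcases h with rfl | ⟨hx, h⟩
    · simpa using Swap.refl _
    · have hne : x ≠ b := fun e => hx.1 (by rw [e])
      rw [List.erase_cons_tail (by simpa using hne)]
      exact ((ih h).cons x).trans (Swap.of_indep hx [] _)

theorem first_erase_of_indep {b c : Fin N × Bool} {u : Word N} (h : Indep Γ b c) :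
    First Γ b (u.erase c) ↔ First Γ b u := by
  induction u with
  | nil => rfl
  | cons x u ih =>
    by_cases hx : x = c
    · subst hx
      rw [List.erase_cons_head, first_cons_of_indep h.symm]
    · rw [List.erase_cons_tail (by simpa using hx), first_cons, first_cons, ih]

theorem Swap.of_cons {b : Fin N × Bool} {u v : Word N} (h : Swap Γ (b :: u) (b :: v)) :
    Swap Γ u v := by
  simpa using h.erase b

/-! ### Reduced words -/

theorem reduced_nil : Reduced Γ [] := by
  rintro ⟨u, x, v, a, ε, h, -⟩
  simp at h

theorem not_reduced_iff {w : Word N} :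
    ¬ Reduced Γ w ↔ ∃ (u x v : Word N) (l : Fin N × Bool),
      w = u ++ l :: x ++ bar l :: v ∧ ∀ y ∈ x, Indep Γ y l := by
  constructor
  · intro h
    have h : ∃ n, ∃ (u x v : Word N) (l : Fin N × Bool), x.length = n ∧
        w = u ++ l :: x ++ bar l :: v ∧ ∀ y ∈ x, ¬ Γ.Adj l.1 y.1 := by
      rw [Reduced, not_not] at h
      obtain ⟨u, x, v, a, ε, rfl, h⟩ := h
      exact ⟨_, u, x, v, (a, ε), rfl, by simp [bar], h⟩
    classical
    obtain ⟨u, x, v, l, hn, hw, hx⟩ := Nat.find_spec h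
    refine ⟨u, x, v, l, hw, fun y hy => ⟨fun e => ?_, fun h => hx y hy h.symm⟩⟩
    obtain ⟨x₁, x₂, rfl⟩ := List.append_of_mem hy
    by_cases hyl : y = l
    · subst hyl
      refine Nat.find_min h (m := x₂.length) ?_ ⟨u ++ y :: x₁, x₂, v, y, rfl, by simp [hw], ?_⟩
      · rw [← hn]; simp; omega
      · exact fun z hz => hx z (by simp [hz])
    · have hyl : y = bar l := by
        rcases y with ⟨a, ε⟩; rcases l with ⟨b, δ⟩
        simp only [Prod.mk.injEq, not_and] at e hyl
        subst e
        have := hyl rfl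
        cases ε <;> cases δ <;> simp_all [bar]
      refine Nat.find_min h (m := x₁.length) ?_
        ⟨u, x₁, x₂ ++ bar l :: v, l, rfl, by simp [hw, hyl], ?_⟩
      · rw [← hn]; simp
      · exact fun z hz => hx z (by simp [hz])
  · rintro ⟨u, x, v, l, rfl, hx⟩ h
    exact h ⟨u, x, v, l.1, l.2, by simp [bar], fun y hy h => (hx y hy).2 h.symm⟩

theorem reduced_cons {l : Fin N × Bool} {u : Word N} :
    Reduced Γ (l :: u) ↔ Reduced Γ u ∧ ¬ First Γ (bar l) u := by
  rw [← not_iff_not, not_reduced_iff, not_and_or, not_not, not_reduced_iff, first_iff]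
  constructor
  · rintro ⟨p, x, v, m, e, hx⟩
    cases p with
    | nil =>
      simp only [List.nil_append, List.cons_append, List.cons.injEq] at e
      obtain ⟨rfl, rfl⟩ := e
      exact .inr ⟨x, v, rfl, hx⟩
    | cons y p =>
      simp only [List.cons_append, List.cons.injEq] at e
      exact .inl ⟨p, x, v, m, by simpa using e.2, hx⟩
  · rintro (⟨p, x, v, m, rfl, hx⟩ | ⟨p, q, rfl, hp⟩)
    · exact ⟨l :: p, x, v, m, by simp, hx⟩
    · exact ⟨[], p, q, l, by simp, hp⟩

theorem Swap.reduced_iff {u v : Word N} (h : Swap Γ u v) : Reduced Γ u ↔ Reduced Γ v := by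
  refine iff_of_eq (h.invariant (Reduced Γ) fun p q l m h => ?_)
  induction p with
  | nil =>
    simp only [List.nil_append, reduced_cons, eq_iff_iff]
    rw [first_cons_of_indep (b := bar l) h.symm, first_cons_of_indep (b := bar m) h]
    tauto
  | cons x p ih =>
    simp only [List.cons_append, reduced_cons, eq_iff_iff] at ih ⊢
    rw [ih, Swap.first_iff (bar x) (Swap.of_indep h p q)]

theorem Reduced.of_append_left {u v : Word N} (h : Reduced Γ (u ++ v)) : Reduced Γ u := by
  rintro ⟨p, x, q, a, ε, rfl, hx⟩
  exact h ⟨p, x, q ++ v, a, ε, by simp, hx⟩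

theorem Reduced.of_append_right {u v : Word N} (h : Reduced Γ (u ++ v)) : Reduced Γ v := by
  rintro ⟨p, x, q, a, ε, rfl, hx⟩
  exact h ⟨u ++ p, x, q, a, ε, by simp, hx⟩

/-! ### Words as group elements -/

theorem elt_nil : elt Γ [] = 1 := by
  rw [elt, ← FreeGroup.one_eq_mk, map_one]

theorem elt_append (u v : Word N) : elt Γ (u ++ v) = elt Γ u * elt Γ v := by
  rw [elt, ← FreeGroup.mul_mk, map_mul]; rfl

theorem elt_cons (l : Fin N × Bool) (u : Word N) : elt Γ (l :: u) = elt Γ [l] * elt Γ u :=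
  elt_append [l] u

theorem elt_flatten (ws : List (Word N)) : elt Γ ws.flatten = (ws.map (elt Γ)).prod := by
  induction ws with
  | nil => exact elt_nil
  | cons w ws ih => rw [List.flatten_cons, elt_append, ih, List.map_cons, List.prod_cons]

theorem elt_eq_prod (w : Word N) : elt Γ w = (w.map fun l => elt Γ [l]).prod := by
  induction w with
  | nil => exact elt_nil
  | cons l w ih => rw [elt_cons, ih, List.map_cons, List.prod_cons]

theorem elt_gen (a : Fin N) : elt Γ [(a, true)] = gen Γ a := rfl

theorem elt_gen_inv (a : Fin N) : elt Γ [(a, false)] = (gen Γ a)⁻¹ := by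
  rw [gen, PresentedGroup.of, ← map_inv, FreeGroup.of, FreeGroup.inv_mk]; rfl

theorem elt_bar (l : Fin N × Bool) : elt Γ [bar l] = (elt Γ [l])⁻¹ := by
  rcases l with ⟨a, _ | _⟩ <;> simp [bar, elt_gen, elt_gen_inv]

theorem elt_letter_mem {H : Subgroup (RAAGroup Γ)} {l : Fin N × Bool} (h : gen Γ l.1 ∈ H) :
    elt Γ [l] ∈ H := by
  rcases l with ⟨a, _ | _⟩
  · rw [elt_gen_inv]
    exact inv_mem h
  · exact h

theorem elt_mem {H : Subgroup (RAAGroup Γ)} {w : Word N} (h : ∀ l ∈ w, gen Γ l.1 ∈ H) :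
    elt Γ w ∈ H := by
  rw [elt_eq_prod]
  refine H.list_prod_mem fun g hg => ?_
  obtain ⟨l, hl, rfl⟩ := List.mem_map.1 hg
  exact elt_letter_mem (h l hl)

theorem gen_commute {a b : Fin N} (h : ¬ Γ.Adj a b) : Commute (gen Γ a) (gen Γ b) := by
  have hrel : gen Γ a * gen Γ b * (gen Γ a)⁻¹ * (gen Γ b)⁻¹ = 1 := by
    simpa [gen, PresentedGroup.of] using
      PresentedGroup.one_of_mem (rels := relators Γ) ⟨a, b, h, rfl⟩
  rwa [mul_inv_eq_one, mul_inv_eq_iff_eq_mul] at hrel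

theorem elt_commute {u v : Word N} (h : ∀ l ∈ u, ∀ m ∈ v, ¬ Γ.Adj l.1 m.1) :
    Commute (elt Γ u) (elt Γ v) := by
  refine Subgroup.mem_centralizer_singleton_iff.1 (elt_mem fun l hl => ?_)
  have hl : elt Γ v ∈ Subgroup.centralizer {gen Γ l.1} :=
    elt_mem fun m hm =>
      Subgroup.mem_centralizer_singleton_iff.2 (gen_commute (h l hl m hm)).symm.eq
  exact Subgroup.mem_centralizer_singleton_iff.2 (Subgroup.mem_centralizer_singleton_iff.1 hl).symm

theorem Swap.elt_eq {u v : Word N} (h : Swap Γ u v) : elt Γ u = elt Γ v := by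
  refine h.invariant (elt Γ) fun p q l m h => ?_
  have hcomm : Commute (elt Γ [l]) (elt Γ [m]) := elt_commute (by simpa using h.2)
  rw [elt_append, elt_append, elt_cons l (m :: q), elt_cons m q, elt_cons m (l :: q), elt_cons l q,
    ← mul_assoc (elt Γ [l]), hcomm.eq, mul_assoc]

theorem elt_surjective : Function.Surjective (elt Γ) := fun g => by
  obtain ⟨f, rfl⟩ := PresentedGroup.mk_surjective (relators Γ) g
  exact ⟨f.toWord, by rw [elt, FreeGroup.mk_toWord]⟩

/-! ### The solution of the word problem -/

open Classical in
/-- The reduced word for `[l][u]` obtained from a reduced word `u`. -/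
noncomputable def act (Γ : SimpleGraph (Fin N)) (l : Fin N × Bool) (u : Word N) : Word N :=
  if First Γ (bar l) u then u.erase (bar l) else l :: u

theorem act_of_first {l : Fin N × Bool} {u : Word N} (h : First Γ (bar l) u) :
    act Γ l u = u.erase (bar l) := if_pos h

theorem act_of_not_first {l : Fin N × Bool} {u : Word N} (h : ¬ First Γ (bar l) u) :
    act Γ l u = l :: u := if_neg h

theorem Swap.act {u v : Word N} (l : Fin N × Bool) (h : Swap Γ u v) :
    Swap Γ (act Γ l u) (act Γ l v) := by
  by_cases hu : First Γ (bar l) u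
  · rw [act_of_first hu, act_of_first ((h.first_iff _).1 hu)]
    exact h.erase _
  · rw [act_of_not_first hu, act_of_not_first (mt (h.first_iff _).2 hu)]
    exact h.cons l

theorem Reduced.act {u : Word N} (l : Fin N × Bool) (h : Reduced Γ u) : Reduced Γ (act Γ l u) := by
  by_cases hu : First Γ (bar l) u
  · rw [act_of_first hu]
    exact (reduced_cons.1 (hu.swap_cons_erase.reduced_iff.1 h)).1
  · rw [act_of_not_first hu]
    exact reduced_cons.2 ⟨h, hu⟩

theorem elt_act (l : Fin N × Bool) (u : Word N) : elt Γ (act Γ l u) = elt Γ [l] * elt Γ u := by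
  by_cases hu : First Γ (bar l) u
  · rw [act_of_first hu, hu.swap_cons_erase.elt_eq, elt_cons (bar l), elt_bar, mul_inv_cancel_left]
  · rw [act_of_not_first hu, elt_cons]

theorem act_bar_act {u : Word N} (l : Fin N × Bool) (h : Reduced Γ u) :
    Swap Γ (act Γ (bar l) (act Γ l u)) u := by
  by_cases hu : First Γ (bar l) u
  · have h1 := (reduced_cons.1 (hu.swap_cons_erase.reduced_iff.1 h)).2
    rw [act_of_first hu, act_of_not_first h1]
    exact hu.swap_cons_erase.symm
  · rw [act_of_not_first hu, act_of_first (first_cons.2 (.inl (by simp))), bar_bar,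
      List.erase_cons_head]
    exact .refl _

theorem act_act_comm {l m : Fin N × Bool} (h : Indep Γ l m) (u : Word N) :
    Swap Γ (act Γ l (act Γ m u)) (act Γ m (act Γ l u)) := by
  have hlm : l ≠ bar m := fun e => h.1 (by rw [e]; rfl)
  have hml : m ≠ bar l := fun e => h.1 (by rw [e]; rfl)
  by_cases hl : First Γ (bar l) u <;> by_cases hm : First Γ (bar m) u
  · have hl' : First Γ (bar l) (u.erase (bar m)) :=
      (first_erase_of_indep (b := bar l) (c := bar m) h).2 hl
    have hm' : First Γ (bar m) (u.erase (bar l)) :=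
      (first_erase_of_indep (b := bar m) (c := bar l) h.symm).2 hm
    rw [act_of_first hl, act_of_first hm, act_of_first hl', act_of_first hm', List.erase_comm]
    exact .refl _
  · have hl' : First Γ (bar l) (m :: u) := (first_cons_of_indep (b := bar l) h.symm).2 hl
    have hm' : ¬ First Γ (bar m) (u.erase (bar l)) :=
      mt (first_erase_of_indep (b := bar m) (c := bar l) h.symm).1 hm
    rw [act_of_first hl, act_of_not_first hm, act_of_first hl', act_of_not_first hm',
      List.erase_cons_tail (by simpa using hml)]
    exact .refl _
  · have hl' : ¬ First Γ (bar l) (u.erase (bar m)) :=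
      mt (first_erase_of_indep (b := bar l) (c := bar m) h).1 hl
    have hm' : First Γ (bar m) (l :: u) := (first_cons_of_indep (b := bar m) h).2 hm
    rw [act_of_not_first hl, act_of_first hm, act_of_not_first hl', act_of_first hm',
      List.erase_cons_tail (by simpa using hlm)]
    exact .refl _
  · have hl' : ¬ First Γ (bar l) (m :: u) := mt (first_cons_of_indep (b := bar l) h.symm).1 hl
    have hm' : ¬ First Γ (bar m) (l :: u) := mt (first_cons_of_indep (b := bar m) h).1 hm
    rw [act_of_not_first hl, act_of_not_first hm, act_of_not_first hl', act_of_not_first hm']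
    exact Swap.of_indep h [] u

/-- Trace equivalence of reduced words. -/
def reducedSetoid (Γ : SimpleGraph (Fin N)) : Setoid {u : Word N // Reduced Γ u} where
  r u v := Swap Γ u.1 v.1
  iseqv := ⟨fun _ => .refl _, fun h => h.symm, fun h h' => h.trans h'⟩

/-- Trace equivalence classes of reduced words. -/
abbrev ReducedTrace (Γ : SimpleGraph (Fin N)) : Type := Quotient (reducedSetoid Γ)

/-- The action of a letter on classes of reduced words. -/
noncomputable def traceAct (Γ : SimpleGraph (Fin N)) (l : Fin N × Bool) :
    ReducedTrace Γ → ReducedTrace Γ :=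
  Quotient.map (sa := reducedSetoid Γ) (sb := reducedSetoid Γ)
    (fun u => ⟨act Γ l u.1, u.2.act l⟩) fun _ _ h => Swap.act l h

theorem traceAct_bar (l : Fin N × Bool) (t : ReducedTrace Γ) :
    traceAct Γ (bar l) (traceAct Γ l t) = t := by
  induction t using Quotient.inductionOn with
  | h u => exact Quotient.sound (act_bar_act l u.2)

/-- The action of a generator on classes of reduced words. -/
noncomputable def genPerm (Γ : SimpleGraph (Fin N)) (a : Fin N) : Equiv.Perm (ReducedTrace Γ) where
  toFun := traceAct Γ (a, true)
  invFun := traceAct Γ (a, false)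
  left_inv := traceAct_bar (a, true)
  right_inv := traceAct_bar (a, false)

theorem genPerm_relators (r : FreeGroup (Fin N)) (hr : r ∈ relators Γ) :
    FreeGroup.lift (genPerm Γ) r = 1 := by
  obtain ⟨a, b, h, rfl⟩ := hr
  simp only [map_mul, map_inv, FreeGroup.lift_apply_of]
  rw [mul_inv_eq_one, mul_inv_eq_iff_eq_mul]
  by_cases hab : a = b
  · rw [hab]
  · ext t
    induction t using Quotient.inductionOn with
    | h u => exact Quotient.sound (act_act_comm (l := (a, true)) (m := (b, true)) ⟨hab, h⟩ u.1)

/-- The action of the group on classes of reduced words. -/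
noncomputable def groupAct (Γ : SimpleGraph (Fin N)) :
    RAAGroup Γ →* Equiv.Perm (ReducedTrace Γ) :=
  PresentedGroup.toGroup (f := genPerm Γ) genPerm_relators

theorem groupAct_letter (l : Fin N × Bool) (t : ReducedTrace Γ) :
    groupAct Γ (elt Γ [l]) t = traceAct Γ l t := by
  have h (a) : groupAct Γ (gen Γ a) = genPerm Γ a := PresentedGroup.toGroup.of _
  rcases l with ⟨a, _ | _⟩
  · rw [elt_gen_inv, map_inv, h]; rfl
  · rw [elt_gen, h]; rfl

theorem groupAct_reduced {u : Word N} (h : Reduced Γ u) :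
    groupAct Γ (elt Γ u) (Quotient.mk (reducedSetoid Γ) ⟨[], reduced_nil⟩) =
      Quotient.mk (reducedSetoid Γ) ⟨u, h⟩ := by
  induction u with
  | nil => rw [elt_nil, map_one]; rfl
  | cons l u ih =>
    have h' := reduced_cons.1 h
    rw [elt_cons, map_mul, Equiv.Perm.mul_apply, ih h'.1, groupAct_letter]
    refine congrArg (Quotient.mk (reducedSetoid Γ)) (Subtype.ext ?_)
    exact act_of_not_first h'.2

theorem swap_of_elt_eq {u v : Word N} (hu : Reduced Γ u) (hv : Reduced Γ v)
    (h : elt Γ u = elt Γ v) : Swap Γ u v := by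
  have := groupAct_reduced hu
  rw [h, groupAct_reduced hv] at this
  exact (Quotient.exact this).symm

/-- A reduced word for the element represented by a word. -/
noncomputable def reduce (Γ : SimpleGraph (Fin N)) : Word N → Word N
  | [] => []
  | l :: u => act Γ l (reduce Γ u)

theorem reduced_reduce (u : Word N) : Reduced Γ (reduce Γ u) := by
  induction u with
  | nil => exact reduced_nil
  | cons l u ih => exact ih.act l

theorem elt_reduce (u : Word N) : elt Γ (reduce Γ u) = elt Γ u := by
  induction u with
  | nil => rfl
  | cons l u ih => rw [reduce, elt_act, ih, ← elt_cons]

theorem exists_reduced (g : RAAGroup Γ) : ∃ u, Reduced Γ u ∧ elt Γ u = g := by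
  obtain ⟨u, rfl⟩ := elt_surjective g
  exact ⟨_, reduced_reduce u, elt_reduce u⟩

theorem length_reduce_le (u : Word N) : (reduce Γ u).length ≤ u.length := by
  induction u with
  | nil => exact le_rfl
  | cons l u ih =>
    rw [reduce]
    by_cases h : First Γ (bar l) (reduce Γ u)
    · rw [act_of_first h, List.length_cons]
      exact (List.length_erase_le.trans ih).trans (Nat.le_succ _)
    · rw [act_of_not_first h]
      exact Nat.succ_le_succ ih

theorem reduce_eq_self_of_length_le {u : Word N} (h : u.length ≤ (reduce Γ u).length) :
    reduce Γ u = u := by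
  induction u with
  | nil => rfl
  | cons l u ih =>
    rw [reduce] at h ⊢
    by_cases hf : First Γ (bar l) (reduce Γ u)
    · have hle := length_reduce_le (Γ := Γ) u
      rw [act_of_first hf, List.length_erase_of_mem hf.mem, List.length_cons] at h
      omega
    · rw [act_of_not_first hf] at h ⊢
      rw [ih (Nat.succ_le_succ_iff.1 h)]

theorem length_reduce_lt {u : Word N} (h : ¬ Reduced Γ u) : (reduce Γ u).length < u.length := by
  by_contra hlt
  exact h (reduce_eq_self_of_length_le (not_lt.1 hlt) ▸ reduced_reduce u)

theorem reduced_of_length_le {u v : Word N} (hu : Reduced Γ u) (h : elt Γ v = elt Γ u)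
    (hl : v.length ≤ u.length) : Reduced Γ v := by
  by_contra hv
  have hlen := (swap_of_elt_eq hu (reduced_reduce v) (by rw [elt_reduce, h])).perm.length_eq
  have := length_reduce_lt hv
  omega

theorem elt_ne_one {u : Word N} (hu : Reduced Γ u) (h : u ≠ []) : elt Γ u ≠ 1 := fun h1 =>
  h (List.perm_nil.1 (swap_of_elt_eq hu reduced_nil (h1.trans elt_nil.symm)).perm)

theorem gen_commute_iff {a b : Fin N} : Commute (gen Γ a) (gen Γ b) ↔ ¬ Γ.Adj a b := by
  refine ⟨fun h hab => ?_, gen_commute⟩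
  have hred : ∀ a b : Fin N, Reduced Γ [(a, true), (b, true)] := fun a b => by
    simp [reduced_cons, first_cons, reduced_nil, bar]
  have hswap : Swap Γ [(a, true), (b, true)] [(b, true), (a, true)] := by
    refine swap_of_elt_eq (hred a b) (hred b a) ?_
    rw [elt_cons, elt_cons (b, true)]
    exact h
  have hfirst := (hswap.first_iff (b, true)).2 (.inl rfl)
  simp [first_cons, hab.ne, Indep, hab] at hfirst

/-! ### Powers of words -/

theorem wordPow_zero (z : Word N) : wordPow z 0 = [] := rfl

theorem wordPow_succ (z : Word N) (r : ℕ) : wordPow z (r + 1) = z ++ wordPow z r := by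
  rw [wordPow, List.replicate_succ, List.flatten_cons, wordPow]

theorem wordPow_one (z : Word N) : wordPow z 1 = z := by
  rw [wordPow_succ, wordPow_zero, List.append_nil]

theorem wordPow_add (z : Word N) (r s : ℕ) : wordPow z (r + s) = wordPow z r ++ wordPow z s := by
  rw [wordPow, List.replicate_add, List.flatten_append, wordPow, wordPow]

theorem wordPow_nil (r : ℕ) : wordPow ([] : Word N) r = [] := by simp [wordPow]

theorem wordPow_mul (z : Word N) (r s : ℕ) : wordPow z (r * s) = wordPow (wordPow z r) s := by
  induction s with
  | zero => rfl
  | succ s ih => rw [Nat.mul_succ, add_comm, wordPow_add, ih, wordPow_succ]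

theorem length_wordPow (z : Word N) (r : ℕ) : (wordPow z r).length = r * z.length := by
  simp [wordPow]

theorem mem_of_mem_wordPow {z : Word N} {r : ℕ} {l : Fin N × Bool} (h : l ∈ wordPow z r) :
    l ∈ z := by
  obtain ⟨_, hy, hl⟩ := List.mem_flatten.1 h
  rwa [← List.eq_of_mem_replicate hy]

theorem mem_wordPow {z : Word N} {r : ℕ} (hr : r ≠ 0) {l : Fin N × Bool} :
    l ∈ wordPow z r ↔ l ∈ z :=
  ⟨mem_of_mem_wordPow, fun h => List.mem_flatten.2 ⟨z, List.mem_replicate.2 ⟨hr, rfl⟩, h⟩⟩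

theorem elt_wordPow (z : Word N) (r : ℕ) : elt Γ (wordPow z r) = elt Γ z ^ r := by
  rw [wordPow, elt_flatten, List.map_replicate, List.prod_replicate]

theorem append_wordPow_rotate (u v : Word N) (n : ℕ) :
    v ++ wordPow (u ++ v) n = wordPow (v ++ u) n ++ v := by
  induction n with
  | zero => rw [wordPow_zero, wordPow_zero, List.append_nil, List.nil_append]
  | succ n ih =>
    rw [wordPow_succ, wordPow_succ, List.append_assoc, List.append_assoc, List.append_assoc, ih]

theorem isRotated_wordPow_append (u v : Word N) (n : ℕ) :
    wordPow (u ++ v) n ~r wordPow (v ++ u) n := by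
  rcases n with _ | n
  · exact .refl _
  · rw [wordPow_succ, List.append_assoc, append_wordPow_rotate, add_comm n, add_comm, wordPow_add,
      wordPow_one, ← List.append_assoc (wordPow _ n)]
    exact List.isRotated_append

theorem exists_wordPow_of_isRotated {u v c : Word N} {i : ℕ} (h : u = wordPow c i) (hv : u ~r v) :
    ∃ d, v = wordPow d i := by
  obtain ⟨k, rfl⟩ := hv
  induction k with
  | zero => exact ⟨c, by rw [List.rotate_zero, h]⟩
  | succ k ih =>
    obtain ⟨d, hd⟩ := ih
    rw [← List.rotate_rotate, hd]
    rcases i with _ | i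
    · exact ⟨[], by rw [wordPow_zero, wordPow_zero, List.rotate_nil]⟩
    rcases d with _ | ⟨x, d⟩
    · exact ⟨[], by rw [wordPow_nil, List.rotate_nil]⟩
    refine ⟨d ++ [x], ?_⟩
    have hslide := append_wordPow_rotate d [x] i
    rw [wordPow_succ, wordPow_succ, List.cons_append, List.rotate_cons_succ, List.rotate_zero]
    simpa using hslide.symm

theorem exists_wordPow_of_append_comm {u v : Word N} (h : u ++ v = v ++ u) :
    ∃ c i j, u = wordPow c i ∧ v = wordPow c j := by
  induction hn : u.length + v.length using Nat.strong_induction_on generalizing u v with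
  | _ n ih =>
    wlog hl : u.length ≤ v.length generalizing u v
    · obtain ⟨c, i, j, hi, hj⟩ :=
        this h.symm ((Nat.add_comm _ _).trans hn) (Nat.le_of_not_le hl)
      exact ⟨c, j, i, hj, hi⟩
    rcases eq_or_ne u [] with rfl | hu
    · exact ⟨v, 0, 1, rfl, (wordPow_one v).symm⟩
    obtain ⟨v, rfl⟩ : u <+: v :=
      List.prefix_of_prefix_length_le (List.prefix_append u v) (h ▸ List.prefix_append v u) hl
    have hu' := List.length_pos_iff.2 hu
    obtain ⟨c, i, j, rfl, rfl⟩ := ih (u.length + v.length) (by simp at hn; omega)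
      (u := u) (v := v) (by simpa using h) rfl
    exact ⟨c, i, i + j, rfl, (wordPow_add _ _ _).symm⟩

theorem append_comm_wordPow {y t : Word N} (h : y ++ t = t ++ y) (m : ℕ) :
    y ++ wordPow t m = wordPow t m ++ y := by
  induction m with
  | zero => rw [wordPow_zero, List.append_nil, List.nil_append]
  | succ m ih => rw [wordPow_succ, ← List.append_assoc, h, List.append_assoc, ih, List.append_assoc]

theorem append_comm_of_append_comm_wordPow {y t : Word N} {e : ℕ}
    (h : y ++ wordPow t (e + 1) = wordPow t (e + 1) ++ y) : y ++ t = t ++ y := by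
  rcases eq_or_ne t [] with rfl | ht
  · rw [List.append_nil, List.nil_append]
  -- A power of `t` longer than `y` starts with `y`, so both sides are prefixes of a power of `t`.
  obtain ⟨M, hM, hyM⟩ : ∃ M, y.length < M ∧ y ++ wordPow t M = wordPow t M ++ y := by
    refine ⟨(e + 1) * (y.length + 1), by nlinarith, ?_⟩
    rw [wordPow_mul]
    exact append_comm_wordPow h _
  have htM : wordPow t M = t ++ wordPow t (M - 1) := by
    rw [← wordPow_succ, Nat.sub_add_cancel (by omega)]
  have hy : y <+: wordPow t M := by
    refine List.prefix_of_prefix_length_le (hyM ▸ List.prefix_append y _)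
      (List.prefix_append _ _) ?_
    rw [length_wordPow]
    nlinarith [List.length_pos_iff.2 ht]
  have hleft : y ++ t <+: wordPow t M ++ wordPow t M := by
    refine (?_ : y ++ t <+: y ++ wordPow t M).trans (hyM ▸ (List.prefix_append_right_inj _).2 hy)
    rw [htM]
    exact (List.prefix_append_right_inj y).2 (List.prefix_append _ _)
  have hright : t ++ y <+: wordPow t M ++ wordPow t M := by
    refine ((List.prefix_append_right_inj t).2 hy).trans ?_
    rw [append_comm_wordPow rfl M]
    exact (List.prefix_append_right_inj _).2 (htM ▸ List.prefix_append t _)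
  exact (List.prefix_of_prefix_length_le hleft hright (by simp [add_comm])).eq_of_length
    (by simp [add_comm])

/-! ### Products of reduced words -/

theorem first_append_iff {b : Fin N × Bool} {u v : Word N} :
    First Γ b (u ++ v) ↔ First Γ b u ∨ ((∀ x ∈ u, Indep Γ x b) ∧ First Γ b v) := by
  induction u with
  | nil => simp
  | cons x u ih =>
    rw [List.cons_append, first_cons, ih, first_cons, List.forall_mem_cons]
    tauto

theorem Reduced.append_append {w p s : Word N} (h : Reduced Γ (w ++ p)) (h' : Reduced Γ (p ++ s))
    (hw : ∀ l ∈ w, ∃ x ∈ p, x.1 = l.1) : Reduced Γ (w ++ p ++ s) := by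
  induction w with
  | nil => exact h'
  | cons l w ih =>
    rw [List.cons_append, reduced_cons] at h
    rw [List.cons_append, List.cons_append, reduced_cons]
    refine ⟨ih h.1 fun m hm => hw m (by simp [hm]), fun hf => h.2 (hf.of_append ?_)⟩
    obtain ⟨x, hx, e⟩ := hw l (by simp)
    exact ⟨x, by simp [hx], e⟩

theorem Reduced.wordPow {u : Word N} (h : Reduced Γ (u ++ u)) (n : ℕ) :
    Reduced Γ (wordPow u n) := by
  induction n with
  | zero => exact reduced_nil
  | succ n ih =>
    rcases n with _ | n
    · rw [wordPow_one]; exact h.of_append_left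
    · rw [wordPow_succ, wordPow_succ, ← List.append_assoc]
      rw [wordPow_succ] at ih
      exact h.append_append ih fun l hl => ⟨l, hl, rfl⟩

theorem exists_cyclic_cancel_of_first {p s : Word N} {l : Fin N × Bool}
    (hf : First Γ (bar l) (p ++ l :: s)) :
    ∃ x₁ x₂ : Word N, p = x₁ ++ bar l :: x₂ ∧ ∀ x ∈ x₁, Indep Γ x l := by
  obtain ⟨p', q', e, hp'⟩ := first_iff.1 hf
  rcases List.append_eq_append_iff.1 e with ⟨a, e1, e2⟩ | ⟨a, e1, e2⟩
  · rcases a with _ | ⟨y, a⟩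
    · exact absurd (List.cons.inj e2).1.symm (bar_ne l)
    · obtain ⟨rfl, -⟩ := List.cons.inj e2
      exact absurd (hp' l (by simp [e1])) (not_indep_self (Γ := Γ) l)
  · rcases a with _ | ⟨y, a⟩
    · exact absurd (List.cons.inj e2).1 (bar_ne l)
    · obtain ⟨rfl, rfl⟩ := List.cons.inj e2
      exact ⟨p', a, e1, hp'⟩

theorem exists_cyclic_cancel {w : Word N} (h : Reduced Γ w) (h' : ¬ Reduced Γ (w ++ w)) :
    ∃ (x₁ x₂ x₃ : Word N) (l : Fin N × Bool), w = x₁ ++ bar l :: x₂ ++ l :: x₃ ∧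
      (∀ x ∈ x₁, Indep Γ x l) ∧ ∀ x ∈ x₃, Indep Γ x l := by
  by_contra hc
  have hsuffix : ∀ s p : Word N, w = p ++ s → Reduced Γ (s ++ w) := by
    intro s
    induction s with
    | nil => exact fun _ _ => h
    | cons l s ih =>
      intro p hp
      rw [List.cons_append, reduced_cons]
      refine ⟨ih (p ++ [l]) (by simp [hp]), fun hf => ?_⟩
      rcases first_append_iff.1 hf with hf | ⟨hs, hf⟩
      · exact (reduced_cons.1 (Reduced.of_append_right (hp ▸ h))).2 hf
      · obtain ⟨x₁, x₂, rfl, hx₁⟩ := exists_cyclic_cancel_of_first (l := l) (hp ▸ hf)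
        exact hc ⟨x₁, x₂, s, l, hp, hx₁, hs⟩
  exact h' (hsuffix w [] rfl)

theorem CyclicallyReduced.append_self {w : Word N} (h : CyclicallyReduced Γ w) :
    Reduced Γ (w ++ w) := by
  by_contra h'
  obtain ⟨x₁, x₂, x₃, l, hw, h₁, h₃⟩ := exists_cyclic_cancel h.1 h'
  exact h.2 ⟨x₁, x₂, x₃, l.1, !l.2, by simpa [bar] using hw, fun y hy => (h₁ y hy).symm.2,
    fun y hy => (h₃ y hy).symm.2⟩

theorem cyclicallyReduced_of_append_self {w : Word N} (h : Reduced Γ (w ++ w)) :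
    CyclicallyReduced Γ w := by
  refine ⟨h.of_append_left, ?_⟩
  rintro ⟨x₁, x₂, x₃, a, ε, rfl, h₁, h₃⟩
  refine h ⟨x₁ ++ [(a, ε)] ++ x₂, x₃ ++ x₁, x₂ ++ [(a, !ε)] ++ x₃, a, !ε, by simp, fun l hl => ?_⟩
  exact (List.mem_append.1 hl).elim (h₃ l) (h₁ l)

theorem exists_cancel {u v : Word N} (hu : Reduced Γ u) (hv : Reduced Γ v) :
    ∃ p q s : Word N, Swap Γ u (p ++ q) ∧ elt Γ u * elt Γ v = elt Γ (p ++ s) ∧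
      Reduced Γ (p ++ s) ∧ q.length + s.length = v.length := by
  induction u with
  | nil => exact ⟨[], [], v, .refl _, by simp [elt_nil], hv, by simp⟩
  | cons l u ih =>
    obtain ⟨p, q, s, hpq, hps, hred, hlen⟩ := ih (reduced_cons.1 hu).1
    by_cases hf : First Γ (bar l) (p ++ s)
    · rcases first_append_iff.1 hf with hf | ⟨hp, hf⟩
      · exact absurd ((hpq.first_iff _).2 (hf.append q)) (reduced_cons.1 hu).2
      · have hm : Swap Γ (p ++ s) (bar l :: p ++ s.erase (bar l)) := by
          refine (hf.swap_cons_erase.append_left p).trans ?_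
          simpa using (swap_append_singleton (bar l) p hp).append_right (s.erase (bar l))
        refine ⟨p, l :: q, s.erase (bar l), ?_, ?_, (reduced_cons.1 (hm.reduced_iff.1 hred)).1, ?_⟩
        · refine (hpq.cons l).trans ?_
          simpa using (swap_append_singleton l p hp).symm.append_right q
        · rw [elt_cons l u, mul_assoc, hps, hm.elt_eq, List.cons_append, elt_cons (bar l), elt_bar,
            mul_inv_cancel_left]
        · have := List.length_pos_of_mem hf.mem
          rw [List.length_erase_of_mem hf.mem, List.length_cons]
          omega
    · refine ⟨l :: p, q, s, hpq.cons l, ?_, reduced_cons.2 ⟨hred, hf⟩, hlen⟩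
      rw [elt_cons l u, mul_assoc, hps, ← elt_cons, List.cons_append]

theorem exists_reduced_append {w : Word N} (hw : CyclicallyReduced Γ w) (g : RAAGroup Γ) :
    ∃ (n : ℕ) (x : Word N), elt Γ w ^ n * g = elt Γ x ∧ Reduced Γ (w ++ x) := by
  obtain ⟨v, hv, rfl⟩ := exists_reduced g
  have hpow := hw.append_self.wordPow
  obtain ⟨p, q, s, hpq, helt, hps, hlen⟩ := exists_cancel (hpow (v.length + 1)) hv
  refine ⟨v.length + 1, p ++ s, by rw [← elt_wordPow, helt], ?_⟩
  rw [← List.append_assoc]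
  refine Reduced.append_append ?_ hps fun l hl => ⟨l, ?_, rfl⟩
  · have hwpq := hpow (v.length + 1 + 1)
    rw [wordPow_succ, (hpq.append_left w).reduced_iff, ← List.append_assoc] at hwpq
    exact hwpq.of_append_left
  -- Every letter of `w` occurs more than `v.length` times in the power, hence not only in `q`.
  · by_contra hlp
    have hcount : v.length + 1 ≤ (wordPow w (v.length + 1)).count l := by
      rw [wordPow, List.count_flatten, List.map_replicate, List.sum_replicate, smul_eq_mul]
      exact Nat.le_mul_of_pos_right _ (List.count_pos_iff.2 hl)
    rw [hpq.perm.count_eq, List.count_append, List.count_eq_zero_of_not_mem hlp] at hcount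
    have := List.count_le_length (a := l) (l := q)
    omega

theorem exists_swap_comm {w : Word N} (hw : CyclicallyReduced Γ w) {g : RAAGroup Γ}
    (hg : Commute (elt Γ w) g) :
    ∃ (n : ℕ) (x : Word N), elt Γ w ^ n * g = elt Γ x ∧ Swap Γ (w ++ x) (x ++ w) := by
  obtain ⟨n, x, hx, hred⟩ := exists_reduced_append hw g
  have hcomm : elt Γ (x ++ w) = elt Γ (w ++ x) := by
    rw [elt_append, elt_append, ← hx]
    exact (((Commute.refl _).pow_right n).mul_right hg).eq.symm
  refine ⟨n, x, hx, swap_of_elt_eq hred (reduced_of_length_le hred hcomm ?_) hcomm.symm⟩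
  simp only [List.length_append, add_comm, le_refl]

/-! ### Torsion-freeness -/

theorem exists_conj_of_not_reduced_append_self {u : Word N} (h : ¬ Reduced Γ (u ++ u)) :
    ∃ (v : Word N) (c : RAAGroup Γ), v.length < u.length ∧ elt Γ u = c * elt Γ v * c⁻¹ := by
  by_cases hu : Reduced Γ u
  · obtain ⟨x₁, x₂, x₃, l, rfl, hx₁, hx₃⟩ := exists_cyclic_cancel hu h
    refine ⟨x₁ ++ x₂ ++ x₃, (elt Γ [l])⁻¹, by simp, ?_⟩
    have hfront := ((swap_append_singleton (bar l) x₁ hx₁).append_right (x₂ ++ l :: x₃)).elt_eq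
    have hback := (swap_append_singleton l x₃ hx₃).elt_eq
    simp only [List.append_assoc, List.cons_append, List.nil_append] at hfront ⊢
    rw [hfront, ← List.cons_append, elt_append, elt_cons, elt_bar, elt_append x₂, ← hback]
    simp only [elt_append, mul_assoc, inv_inv]
  · exact ⟨reduce Γ u, 1, length_reduce_lt hu, by rw [elt_reduce, one_mul, inv_one, mul_one]⟩

theorem exists_conj_reduced_append_self (g : RAAGroup Γ) :
    ∃ (u : Word N) (c : RAAGroup Γ), Reduced Γ (u ++ u) ∧ g = c * elt Γ u * c⁻¹ := by
  obtain ⟨u, rfl⟩ := elt_surjective g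
  induction hn : u.length using Nat.strong_induction_on generalizing u with
  | _ n ih =>
    by_cases hu : Reduced Γ (u ++ u)
    · exact ⟨u, 1, hu, by group⟩
    · obtain ⟨v, c, hlt, hv⟩ := exists_conj_of_not_reduced_append_self hu
      obtain ⟨x, d, hx, hvx⟩ := ih _ (hn ▸ hlt) v rfl
      exact ⟨x, c * d, hx, by rw [hv, hvx]; group⟩

theorem not_isOfFinOrder {g : RAAGroup Γ} (hg : g ≠ 1) : ¬ IsOfFinOrder g := by
  obtain ⟨u, c, hu, rfl⟩ := exists_conj_reduced_append_self g
  rw [isOfFinOrder_iff_pow_eq_one]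
  rintro ⟨n, hn, h⟩
  rw [conj_pow, conj_eq_one_iff, ← elt_wordPow] at h
  have hnil : wordPow u n = [] := by_contra fun hne => elt_ne_one (hu.wordPow n) hne h
  have hlen := congrArg List.length hnil
  rw [length_wordPow, List.length_nil, Nat.mul_eq_zero, List.length_eq_zero_iff] at hlen
  obtain rfl := hlen.resolve_left hn.ne'
  exact hg (by rw [elt_nil, mul_one, mul_inv_cancel])

/-! ### Lexicographic normal forms -/

/-- The first letter of each suffix has the largest index among the first letters of the trace
equivalent words. -/
def LexNormal (Γ : SimpleGraph (Fin N)) : Word N → Prop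
  | [] => True
  | a :: t => LexNormal Γ t ∧ ∀ b, First Γ b (a :: t) → b.1 ≤ a.1

theorem Normal.lexNormal {w : Word N} (h : Normal Γ w) : LexNormal Γ w := by
  induction w with
  | nil => trivial
  | cons a t ih =>
    refine ⟨ih ⟨(reduced_cons.1 h.1).1, fun v hv => h.2 v (hv.trans (List.suffix_cons a t))⟩,
      fun b hb => ?_⟩
    have hs := hb.swap_cons_erase
    exact h.2 _ List.suffix_rfl a t rfl b _ (hs.reduced_iff.1 h.1) hs.elt_eq.symm

theorem LexNormal.append {u v : Word N} (hu : LexNormal Γ u) (hv : LexNormal Γ v)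
    (h : ∀ b, First Γ b v → ∀ a ∈ u, b.1 ≤ a.1) : LexNormal Γ (u ++ v) := by
  induction u with
  | nil => exact hv
  | cons a u ih =>
    refine ⟨ih hu.1 fun b hb c hc => h b hb c (by simp [hc]), fun b hb => ?_⟩
    rcases (first_append_iff (u := a :: u)).1 hb with hb | ⟨-, hb⟩
    · exact hu.2 b hb
    · exact h b hb a (by simp)

theorem LexNormal.eq_of_swap {u v : Word N} (hu : LexNormal Γ u) (hv : LexNormal Γ v)
    (h : Swap Γ u v) : u = v := by
  induction u generalizing v with
  | nil => exact (List.nil_perm.1 h.perm).symm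
  | cons a u ih =>
    rcases v with _ | ⟨b, v⟩
    · exact absurd h.perm.length_eq (by simp)
    have hb : First Γ b (a :: u) := (h.first_iff b).2 (.inl rfl)
    have ha : First Γ a (b :: v) := (h.first_iff a).1 (.inl rfl)
    have hab : a.1 = b.1 := le_antisymm (hv.2 a ha) (hu.2 b hb)
    rcases hb with rfl | hb
    · rw [ih hu.1 hv.1 h.of_cons]
    · exact absurd hab hb.1.1

theorem exists_lexNormal (u : Word N) : ∃ v, LexNormal Γ v ∧ Swap Γ u v := by
  classical
  induction hn : u.length generalizing u with
  | zero => exact ⟨[], trivial, by rw [List.length_eq_zero_iff.1 hn]; exact .refl _⟩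
  | succ n ih =>
    obtain ⟨a, t, rfl⟩ := List.exists_cons_of_length_eq_add_one hn
    obtain ⟨b, hb, hmax⟩ := Finset.exists_max_image
      (Finset.univ.filter fun b => First Γ b (a :: t)) Prod.fst ⟨a, by simp [first_cons]⟩
    simp only [Finset.mem_filter, Finset.mem_univ, true_and] at hb hmax
    have hs := hb.swap_cons_erase
    obtain ⟨v, hv, hv'⟩ := ih ((a :: t).erase b) (by rw [List.length_erase_of_mem hb.mem, hn]; rfl)
    have hs' := hs.trans (hv'.cons b)
    exact ⟨b :: v, ⟨hv, fun c hc => hmax c ((hs'.first_iff c).2 hc)⟩, hs'⟩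

theorem LexNormal.append_comm {w y : Word N} (hw : LexNormal Γ w) (hy : LexNormal Γ y)
    (hfirst : ∀ b, First Γ b w → ∀ a ∈ w, b.1 ≤ a.1) (hsupp : ∀ l ∈ y, ∃ x ∈ w, x.1 = l.1)
    (hs : Swap Γ (w ++ y) (y ++ w)) : w ++ y = y ++ w := by
  refine LexNormal.eq_of_swap (hw.append hy fun b hb a ha => ?_)
    (hy.append hw fun b hb a ha => ?_) hs
  · exact hfirst b (((hs.first_iff b).2 (hb.append _)).of_append (hsupp b hb.mem)) a ha
  · obtain ⟨x, hx, e⟩ := hsupp a ha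
    exact e ▸ hfirst b hb x hx

/-! ### Word roots -/

/-- The word `w` is a power of `z` with the largest possible exponent. Since the empty word is every
power of itself, it has no root in this sense. -/
def IsWordRoot (w z : Word N) : Prop :=
  ∃ r : ℕ, w = wordPow z r ∧ ∀ (z' : Word N) (r' : ℕ), w = wordPow z' r' → r' ≤ r

namespace IsWordRoot

variable {w z : Word N}

theorem ne_nil (h : IsWordRoot w z) : w ≠ [] := by
  rintro rfl
  obtain ⟨r, -, hmax⟩ := h
  exact absurd (hmax [] (r + 1) (wordPow_nil _).symm) (Nat.not_succ_le_self r)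

theorem exists_succ (h : IsWordRoot w z) : ∃ e, w = wordPow z (e + 1) := by
  have hne := h.ne_nil
  obtain ⟨_ | e, rfl, -⟩ := h
  · exact absurd rfl hne
  · exact ⟨e, rfl⟩

theorem root_ne_nil (h : IsWordRoot w z) : z ≠ [] := by
  rintro rfl
  obtain ⟨e, he⟩ := h.exists_succ
  exact h.ne_nil (he.trans (wordPow_nil _))

theorem mem_iff (h : IsWordRoot w z) {l : Fin N × Bool} : l ∈ z ↔ l ∈ w := by
  obtain ⟨e, rfl⟩ := h.exists_succ
  exact (mem_wordPow (Nat.succ_ne_zero e)).symm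

theorem rotate {u v : Word N} (h : IsWordRoot w (u ++ v)) :
    ∃ e, w = wordPow (u ++ v) (e + 1) ∧ IsWordRoot (wordPow (v ++ u) (e + 1)) (v ++ u) := by
  have hw := h.ne_nil
  obtain ⟨_ | e, rfl, hmax⟩ := h
  · exact absurd rfl hw
  refine ⟨e, rfl, e + 1, rfl, fun z' r' hz' => ?_⟩
  obtain ⟨d, hd⟩ := exists_wordPow_of_isRotated hz' (isRotated_wordPow_append v u (e + 1))
  exact hmax d r' hd

theorem exists_wordPow_of_append_comm {y : Word N} (h : IsWordRoot w z) (hy : w ++ y = y ++ w) :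
    ∃ i, y = wordPow z i := by
  have hz := h.root_ne_nil
  have hw := h.ne_nil
  obtain ⟨_ | e, rfl, hmax⟩ := h
  · exact absurd rfl hw
  obtain ⟨c, i, j, rfl, rfl⟩ :=
    RAAG.exists_wordPow_of_append_comm (append_comm_of_append_comm_wordPow hy.symm)
  have hj : j * (e + 1) ≤ 1 * (e + 1) :=
    (hmax c _ (wordPow_mul c j (e + 1)).symm).trans_eq (one_mul _).symm
  have hj0 : j ≠ 0 := by
    rintro rfl
    exact hz rfl
  have hj1 : j = 1 := by have := Nat.le_of_mul_le_mul_right hj e.succ_pos; omega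
  exact ⟨i, by rw [hj1, wordPow_one]⟩

end IsWordRoot

theorem Swap.comm_rotate {u v x : Word N} {n : ℕ}
    (h : Swap Γ (wordPow (u ++ v) n ++ x) (x ++ wordPow (u ++ v) n)) :
    Swap Γ (wordPow (v ++ u) n ++ (v ++ x ++ u)) (v ++ x ++ u ++ wordPow (v ++ u) n) := by
  have hl : wordPow (v ++ u) n ++ (v ++ x ++ u) = v ++ (wordPow (u ++ v) n ++ x) ++ u := by
    rw [List.append_assoc v, ← List.append_assoc, ← append_wordPow_rotate u v]
    simp only [List.append_assoc]
  have hr : v ++ x ++ u ++ wordPow (v ++ u) n = v ++ (x ++ wordPow (u ++ v) n) ++ u := by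
    rw [List.append_assoc, append_wordPow_rotate v u]
    simp only [List.append_assoc]
  rw [hl, hr]
  exact (h.append_left v).append_right u

theorem LexNormal.exists_swap_wordPow {w z x : Word N} (hw : LexNormal Γ w)
    (hfirst : ∀ b, First Γ b w → ∀ a ∈ w, b.1 ≤ a.1) (hz : IsWordRoot w z)
    (hx : ∀ l ∈ x, ∃ m ∈ w, m.1 = l.1) (hs : Swap Γ (w ++ x) (x ++ w)) :
    ∃ i, Swap Γ x (wordPow z i) := by
  obtain ⟨y, hy, hxy⟩ := exists_lexNormal (Γ := Γ) x
  have hcomm : w ++ y = y ++ w :=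
    hw.append_comm hy hfirst (fun l hl => hx l (hxy.perm.mem_iff.2 hl))
      (((hxy.symm.append_left w).trans hs).trans (hxy.append_right w))
  obtain ⟨i, rfl⟩ := hz.exists_wordPow_of_append_comm hcomm
  exact ⟨i, hxy⟩

theorem elt_mem_zpowers_of_swap_comm {w z x : Word N} (hw : CyclicNormalForm Γ w)
    (hz : IsWordRoot w z) (hx : ∀ l ∈ x, ∃ m ∈ w, m.1 = l.1) (hs : Swap Γ (w ++ x) (x ++ w)) :
    elt Γ x ∈ Subgroup.zpowers (elt Γ z) := by
  obtain ⟨l, hl, hmin⟩ := Finset.exists_min_image z.toFinset Prod.fst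
    ((List.toFinset_nonempty_iff z).2 hz.root_ne_nil)
  simp only [List.mem_toFinset] at hl hmin
  have hmem := fun m => hz.mem_iff (l := m)
  -- Rotate `w` so that it starts with its smallest generator.
  obtain ⟨u, t, rfl⟩ := List.append_of_mem hl
  obtain ⟨e, rfl, hroot⟩ := hz.rotate
  have hrot := isRotated_wordPow_append u (l :: t) (e + 1)
  have hnormal := (hw.2 _ hrot.symm).lexNormal
  have hfirst : ∀ b, First Γ b (wordPow (l :: t ++ u) (e + 1)) →
      ∀ a ∈ wordPow (l :: t ++ u) (e + 1), b.1 ≤ a.1 := by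
    intro b hb a ha
    have hle : b.1 ≤ l.1 := by
      rw [wordPow_succ] at hnormal hb
      exact hnormal.2 b hb
    exact hle.trans (hmin a ((hmem a).2 (hrot.perm.mem_iff.2 ha)))
  have hsupp : ∀ b ∈ l :: t ++ x ++ u, ∃ m ∈ wordPow (l :: t ++ u) (e + 1), m.1 = b.1 := by
    intro b hb
    have hb : b ∈ x ∨ b ∈ u ++ l :: t := by
      simp only [List.mem_append] at hb ⊢
      tauto
    obtain ⟨m, hm, hmb⟩ := hb.elim (hx b) fun hb => ⟨b, (hmem b).1 hb, rfl⟩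
    exact ⟨m, hrot.perm.mem_iff.1 hm, hmb⟩
  obtain ⟨i, hi⟩ := hnormal.exists_swap_wordPow hfirst hroot hsupp hs.comm_rotate
  have hpow : elt Γ (u ++ l :: t) * elt Γ x = elt Γ (u ++ l :: t) ^ i := by
    have hconj := ((hi.append_left u).append_right (l :: t)).elt_eq
    rw [append_wordPow_rotate, List.append_assoc (wordPow _ i), elt_append (wordPow _ i),
      elt_wordPow] at hconj
    refine mul_right_cancel (Eq.trans ?_ hconj)
    simp only [← elt_append, List.append_assoc]
  rw [eq_inv_mul_of_mul_eq hpow]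
  exact mul_mem (inv_mem (Subgroup.mem_zpowers _)) (pow_mem (Subgroup.mem_zpowers _) i)

/-! ### Supports and centralizers -/

theorem mem_support_flatten {ws : List (Word N)} {a : Fin N} :
    a ∈ support ws.flatten ↔ ∃ w ∈ ws, a ∈ support w := by
  simp only [support, Set.mem_ofPred_eq, List.mem_flatten]
  tauto

/-- The words `u` and `v` have disjoint supports that commute with each other. -/
def Separated (Γ : SimpleGraph (Fin N)) (u v : Word N) : Prop :=
  ∀ a ∈ support u, ∀ b ∈ support v, a ≠ b ∧ GenCommute Γ a b

instance : Std.Symm (Separated Γ) :=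
  ⟨fun _ _ h a ha b hb => ⟨(h b hb a ha).1.symm, fun hadj => (h b hb a ha).2 hadj.symm⟩⟩

theorem Separated.disjoint {u v : Word N} (h : Separated Γ u v) :
    Disjoint (support u) (support v) :=
  Set.disjoint_left.2 fun a ha hb => (h a ha a hb).1 rfl

theorem Swap.filter_pair {a b : Fin N} (hab : Γ.Adj a b) {u v : Word N} (h : Swap Γ u v) :
    u.filter (fun l => l.1 = a ∨ l.1 = b) = v.filter (fun l => l.1 = a ∨ l.1 = b) := by
  refine h.invariant (List.filter fun l => l.1 = a ∨ l.1 = b) fun p q l m h => ?_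
  simp only [List.filter_append, List.filter_cons]
  split_ifs with hl hm
  · exfalso
    rcases of_decide_eq_true hl with hl | hl <;> rcases of_decide_eq_true hm with hm | hm
    · exact h.1 (hl.trans hm.symm)
    · exact h.2 (hl ▸ hm ▸ hab)
    · exact h.2 (hl ▸ hm ▸ hab.symm)
    · exact h.1 (hl.trans hm.symm)
  all_goals rfl

theorem not_adj_of_swap_comm {w x : Word N} (hs : Swap Γ (w ++ x) (x ++ w)) {l : Fin N × Bool}
    {b : Fin N} (hl : l ∈ x) (hlw : l.1 ∉ support w) (hb : b ∈ support w) : ¬ Γ.Adj l.1 b := by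
  intro hadj
  obtain ⟨m, hm, rfl⟩ := hb
  -- The projections of `w` and `x` to the letters over `l.1` and `b` are powers of a common word.
  have hproj := hs.filter_pair hadj
  rw [List.filter_append, List.filter_append] at hproj
  obtain ⟨c, i, j, hi, hj⟩ := exists_wordPow_of_append_comm hproj
  have hlc : l ∈ wordPow c j := hj ▸ List.mem_filter.2 ⟨hl, by simp⟩
  have hmc : m ∈ wordPow c i := hi ▸ List.mem_filter.2 ⟨hm, by simp⟩
  have hi0 : i ≠ 0 := by
    rintro rfl
    exact List.not_mem_nil hmc
  have hlw' := (mem_wordPow hi0).2 (mem_of_mem_wordPow hlc)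
  rw [← hi] at hlw'
  exact hlw ⟨l, (List.mem_filter.1 hlw').1, rfl⟩

theorem elt_eq_filter_mul_filter {x : Word N} (f : Fin N × Bool → Bool)
    (h : ∀ l ∈ x, ∀ m ∈ x, f l = true → f m = false → ¬ Γ.Adj l.1 m.1) :
    elt Γ x = elt Γ (x.filter f) * elt Γ (x.filter fun l => !f l) := by
  induction x with
  | nil => simp [elt_nil]
  | cons l x ih =>
    have ih := ih fun l hl m hm => h l (by simp [hl]) m (by simp [hm])
    cases hf : f l
    · have hcomm : Commute (elt Γ [l]) (elt Γ (x.filter f)) := by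
        refine elt_commute fun a ha b hb hadj => ?_
        rw [List.mem_singleton.1 ha] at hadj
        obtain ⟨hbx, hfb⟩ := List.mem_filter.1 hb
        exact h b (by simp [hbx]) l (by simp) hfb hf hadj.symm
      rw [elt_cons, ih, List.filter_cons_of_neg (by simp [hf]),
        List.filter_cons_of_pos (by simp [hf]), elt_cons l (x.filter fun l => !f l),
        ← mul_assoc, ← mul_assoc, hcomm.eq]
    · rw [elt_cons, ih, List.filter_cons_of_pos hf, List.filter_cons_of_neg (by simp [hf]),
        elt_cons l (x.filter f), mul_assoc]

open Classical in
theorem elt_mem_of_filter_mem {H : Subgroup (RAAGroup Γ)} {ws : List (Word N)} {x : Word N}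
    (hdisj : ws.Pairwise fun u v => Disjoint (support u) (support v))
    (hx : ∀ l ∈ x, ∀ w ∈ ws, l.1 ∉ support w → ∀ b ∈ support w, ¬ Γ.Adj l.1 b)
    (hfilter : ∀ w ∈ ws, elt Γ (x.filter fun l => l.1 ∈ support w) ∈ H)
    (hgen : ∀ l ∈ x, (∀ w ∈ ws, l.1 ∉ support w) → gen Γ l.1 ∈ H) : elt Γ x ∈ H := by
  induction ws generalizing x with
  | nil => exact elt_mem fun l hl => hgen l hl (by simp)
  | cons w ws ih =>
    rw [List.pairwise_cons] at hdisj
    rw [elt_eq_filter_mul_filter fun l => l.1 ∈ support w]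
    · refine mul_mem (hfilter w (by simp)) (ih hdisj.2 (fun l hl v hv => ?_) (fun v hv => ?_)
        fun l hl hlws => ?_)
      · exact hx l (List.mem_filter.1 hl).1 v (by simp [hv])
      · rw [List.filter_filter]
        convert hfilter v (by simp [hv]) using 2
        refine List.filter_congr fun l _ => ?_
        simpa using fun hv' => Set.disjoint_right.1 (hdisj.1 v hv) hv'
      · obtain ⟨hlx, hlw⟩ := List.mem_filter.1 hl
        exact hgen l hlx (List.forall_mem_cons.2 ⟨by simpa using hlw, hlws⟩)
    · intro l _ m hm hl hmw hadj
      exact hx m hm w (by simp) (by simpa using hmw) l.1 (by simpa using hl) hadj.symm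

open Classical in
theorem filter_support_flatten {ws : List (Word N)}
    (hdisj : ws.Pairwise fun u v => Disjoint (support u) (support v)) {w : Word N} (hw : w ∈ ws) :
    ws.flatten.filter (fun l => l.1 ∈ support w) = w := by
  have hnil {us : List (Word N)} (h : ∀ u ∈ us, Disjoint (support w) (support u)) :
      us.flatten.filter (fun l => l.1 ∈ support w) = [] := by
    refine List.filter_eq_nil_iff.2 fun l hl => ?_
    obtain ⟨u, hu, hlu⟩ := List.mem_flatten.1 hl
    simpa using Set.disjoint_right.1 (h u hu) ⟨l, hlu, rfl⟩
  have hself : w.filter (fun l => l.1 ∈ support w) = w :=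
    List.filter_eq_self.2 fun l hl => decide_eq_true ⟨l, hl, rfl⟩
  obtain ⟨us, vs, rfl⟩ := List.append_of_mem hw
  rw [List.pairwise_append, List.pairwise_cons] at hdisj
  rw [List.flatten_append, List.flatten_cons, List.filter_append, List.filter_append, hself,
    hnil fun u hu => (hdisj.2.2 u hu w (by simp)).symm, hnil hdisj.2.1.1, List.nil_append,
    List.append_nil]

theorem mem_of_commute_elt_flatten {ws : List (Word N)} (hred : CyclicallyReduced Γ ws.flatten)
    (hnormal : ∀ w ∈ ws, CyclicNormalForm Γ w) (hsep : ws.Pairwise (Separated Γ))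
    {H : Subgroup (RAAGroup Γ)} (hroot : ∀ w ∈ ws, ∃ z, IsWordRoot w z ∧ elt Γ z ∈ H)
    (hgen : ∀ a ∉ support ws.flatten, (∀ b ∈ support ws.flatten, ¬ Γ.Adj a b) → gen Γ a ∈ H)
    {g : RAAGroup Γ} (hg : Commute (elt Γ ws.flatten) g) : g ∈ H := by
  classical
  obtain ⟨n, x, hx, hs⟩ := exists_swap_comm hred hg
  have hdisj := hsep.imp Separated.disjoint
  have hflatten : elt Γ ws.flatten ∈ H := by
    rw [elt_flatten]
    refine H.list_prod_mem (List.forall_mem_map.2 fun w hw => ?_)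
    obtain ⟨z, ⟨r, rfl, -⟩, hz⟩ := hroot w hw
    exact elt_wordPow (Γ := Γ) z r ▸ pow_mem hz r
  rw [eq_inv_mul_of_mul_eq hx]
  refine mul_mem (inv_mem (pow_mem hflatten n)) (elt_mem_of_filter_mem hdisj
    (fun l hl w hw hlw b hb => ?_) (fun w hw => ?_) fun l hl hlws => ?_)
  · by_cases hlws : l.1 ∈ support ws.flatten
    · obtain ⟨v, hv, hlv⟩ := mem_support_flatten.1 hlws
      exact (hsep.forall hv hw (fun e => hlw (e ▸ hlv)) _ hlv _ hb).2
    · exact not_adj_of_swap_comm hs hl hlws (mem_support_flatten.2 ⟨w, hw, hb⟩)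
  · obtain ⟨z, hz, hzH⟩ := hroot w hw
    have hsw := hs.filter fun l => l.1 ∈ support w
    rw [List.filter_append, List.filter_append, filter_support_flatten hdisj hw] at hsw
    refine Subgroup.zpowers_le.2 hzH (elt_mem_zpowers_of_swap_comm (hnormal w hw) hz ?_ hsw)
    intro l hl
    have hlw : l.1 ∈ support w := by simpa only [decide_eq_true_eq] using (List.mem_filter.1 hl).2
    exact hlw
  · have hl' : l.1 ∉ support ws.flatten := fun h =>
      let ⟨w, hw, hlw⟩ := mem_support_flatten.1 h
      hlws w hw hlw
    exact hgen _ hl' fun b hb => not_adj_of_swap_comm hs hl hl' hb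

/-! ### Minimal roots -/

theorem IsWordRoot.cyclicallyReduced {w z : Word N} (h : IsWordRoot w z)
    (hw : CyclicallyReduced Γ w) : CyclicallyReduced Γ z := by
  obtain ⟨e, rfl⟩ := h.exists_succ
  have hww := hw.append_self
  rw [← wordPow_add, ← add_assoc, wordPow_succ, add_right_comm, wordPow_succ,
    ← List.append_assoc] at hww
  exact cyclicallyReduced_of_append_self hww.of_append_left

open Classical in
/-- The endomorphism that kills the generators in a set. -/
noncomputable def kill (Γ : SimpleGraph (Fin N)) (S : Set (Fin N)) : RAAGroup Γ →* RAAGroup Γ :=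
  PresentedGroup.toGroup (f := fun a => if a ∈ S then 1 else gen Γ a) <| by
    rintro r ⟨a, b, h, rfl⟩
    simp only [map_mul, map_inv, FreeGroup.lift_apply_of]
    rw [mul_inv_eq_one, mul_inv_eq_iff_eq_mul]
    split_ifs
    · rfl
    · rw [one_mul, mul_one]
    · rw [one_mul, mul_one]
    · exact (gen_commute h).eq

theorem kill_gen_of_mem {S : Set (Fin N)} {a : Fin N} (h : a ∈ S) : kill Γ S (gen Γ a) = 1 := by
  rw [kill, gen, PresentedGroup.toGroup.of, if_pos h]

theorem kill_gen_of_notMem {S : Set (Fin N)} {a : Fin N} (h : a ∉ S) :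
    kill Γ S (gen Γ a) = gen Γ a := by
  rw [kill, gen, PresentedGroup.toGroup.of, if_neg h]; rfl

theorem kill_elt {S : Set (Fin N)} {w : Word N} (h : ∀ l ∈ w, l.1 ∈ S) :
    kill Γ S (elt Γ w) = 1 :=
  MonoidHom.mem_ker.1 (elt_mem fun l hl => MonoidHom.mem_ker.2 (kill_gen_of_mem (h l hl)))

theorem exists_zpow_mul_of_commute {w z : Word N} (hw : CyclicNormalForm Γ w)
    (hz : IsWordRoot w z) {g : RAAGroup Γ} (hg : Commute (elt Γ w) g) :
    ∃ (k : ℤ) (c : RAAGroup Γ), g = elt Γ z ^ k * c ∧ kill Γ (support w) c = c := by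
  let K : Subgroup (RAAGroup Γ) :=
    (kill Γ (support w)).eqLocus (MonoidHom.id _) ⊓ Subgroup.centralizer {elt Γ z}
  have hK (n : Multiplicative ℤ) (c : K) : Commute (zpowersHom _ (elt Γ z) n) (K.subtype c) :=
    Commute.zpow_left (Subgroup.mem_centralizer_singleton_iff.1 c.2.2).symm _
  let f := (zpowersHom _ (elt Γ z)).noncommCoprod K.subtype hK
  have hroot : elt Γ z ∈ f.range := ⟨(Multiplicative.ofAdd 1, 1), by simp [f]⟩
  have hgen (a : Fin N) (haw : a ∉ support w) (ha : ∀ b ∈ support w, ¬ Γ.Adj a b) :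
      gen Γ a ∈ f.range := by
    have hcomm : Commute (elt Γ [(a, true)]) (elt Γ z) := elt_commute fun l hl m hm => by
      rw [List.mem_singleton.1 hl]
      exact ha _ ⟨m, hz.mem_iff.1 hm, rfl⟩
    have haK : gen Γ a ∈ K :=
      ⟨kill_gen_of_notMem haw, Subgroup.mem_centralizer_singleton_iff.2 hcomm.eq⟩
    exact ⟨(1, ⟨_, haK⟩), by simp [f]⟩
  obtain ⟨⟨k, c⟩, rfl⟩ : g ∈ f.range := by
    rw [← List.flatten_singleton (l := w)] at hg hgen
    exact mem_of_commute_elt_flatten (by rw [List.flatten_singleton]; exact hw.1)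
      (List.forall_mem_singleton.2 hw) (List.pairwise_singleton _ _)
      (List.forall_mem_singleton.2 ⟨z, hz, hroot⟩) hgen hg
  exact ⟨k.toAdd, c, by simp [f], c.2.1⟩

theorem mem_zpowers_root {w z : Word N} (hw : CyclicNormalForm Γ w) (hz : IsWordRoot w z)
    {g : RAAGroup Γ} {s : ℤ} (hg : g ^ s = elt Γ w) : g ∈ Subgroup.zpowers (elt Γ z) := by
  obtain ⟨k, c, rfl, hc⟩ :=
    exists_zpow_mul_of_commute hw hz (g := g) (hg ▸ (Commute.refl g).zpow_left s)
  have hs : s ≠ 0 := by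
    rintro rfl
    exact elt_ne_one hw.1.1 hz.ne_nil (by rw [← hg, zpow_zero])
  have hkill := congrArg (kill Γ (support w)) hg
  rw [map_zpow, map_mul, map_zpow, kill_elt (S := support w) fun l hl => ⟨l, hz.mem_iff.1 hl, rfl⟩,
    kill_elt (S := support w) fun l hl => ⟨l, hl, rfl⟩, one_zpow, one_mul, hc] at hkill
  obtain rfl : c = 1 := by_contra fun hc1 =>
    not_isOfFinOrder hc1 (isOfFinOrder_iff_zpow_eq_one.2 ⟨s, hs, hkill⟩)
  exact ⟨k, (mul_one _).symm⟩

theorem isMinimalRoot_of_isWordRoot {w z : Word N} (hw : CyclicNormalForm Γ w)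
    (hz : IsWordRoot w z) : IsMinimalRoot Γ w z := by
  have hred := hz.cyclicallyReduced hw.1
  have hself : IsInfiniteCyclicThrough (elt Γ w) (Subgroup.zpowers (elt Γ z)) := by
    refine ⟨inferInstance, ?_, ?_⟩
    · rw [← SetLike.coe_sort_coe, Set.infinite_coe_iff, infinite_zpowers]
      exact not_isOfFinOrder (elt_ne_one hred.1 hz.root_ne_nil)
    · obtain ⟨e, rfl⟩ := hz.exists_succ
      exact elt_wordPow (Γ := Γ) z _ ▸ pow_mem (Subgroup.mem_zpowers _) _
  have hle : ∀ K, IsInfiniteCyclicThrough (elt Γ w) K → K ≤ Subgroup.zpowers (elt Γ z) := by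
    rintro K ⟨hc, -, hwK⟩
    obtain ⟨g, rfl⟩ := K.isCyclic_iff_exists_zpowers_eq_top.1 hc
    obtain ⟨s, hs⟩ := hwK
    exact Subgroup.zpowers_le.2 (mem_zpowers_root hw hz hs)
  exact
    { cyclicallyReduced := hred
      maximal := ⟨hself, fun K hK _ => hle K hK⟩
      unique := fun K hK => le_antisymm (hle K hK.1) (hK.2 hself (hle K hK.1))
      power := hz }

theorem commute_elt_root_elt_flatten {ws : List (Word N)} (hsep : ws.Pairwise (Separated Γ))
    {w z : Word N} (hw : w ∈ ws) (hz : IsWordRoot w z) : Commute (elt Γ z) (elt Γ ws.flatten) := by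
  rw [elt_flatten]
  refine Commute.list_prod_right _ _ (List.forall_mem_map.2 fun v hv => ?_)
  by_cases hvw : v = w
  · obtain ⟨e, he⟩ := hz.exists_succ
    rw [hvw, he, elt_wordPow]
    exact (Commute.refl _).pow_right _
  · exact elt_commute fun l hl m hm =>
      (hsep.forall hw hv (Ne.symm hvw) _ ⟨l, hz.mem_iff.1 hl, rfl⟩ _ ⟨m, hm, rfl⟩).2

theorem closure_eq_centralizer {ws : List (Word N)} (hred : CyclicallyReduced Γ ws.flatten)
    (hnormal : ∀ w ∈ ws, CyclicNormalForm Γ w) (hsep : ws.Pairwise (Separated Γ))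
    {root : Word N → Word N} (hroot : ∀ w ∈ ws, IsWordRoot w (root w)) {gs : List (Fin N)}
    (hgs : ∀ a, a ∈ gs ↔ ∀ b ∈ support ws.flatten, ¬ Γ.Adj a b) :
    Subgroup.closure {g | ∃ v ∈ ws.map root ++ gs.map (fun a => [(a, true)]), g = elt Γ v} =
      Subgroup.centralizer {elt Γ ws.flatten} := by
  refine le_antisymm ((Subgroup.closure_le _).2 ?_) fun g hg => ?_
  · rintro _ ⟨v, hv, rfl⟩
    refine Subgroup.mem_centralizer_singleton_iff.2 (Commute.eq ?_)
    rcases List.mem_append.1 hv with hv | hv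
    · obtain ⟨w, hw, rfl⟩ := List.mem_map.1 hv
      exact commute_elt_root_elt_flatten hsep hw (hroot w hw)
    · obtain ⟨a, ha, rfl⟩ := List.mem_map.1 hv
      refine elt_commute fun l hl m hm => ?_
      rw [List.mem_singleton.1 hl]
      exact (hgs a).1 ha _ ⟨m, hm, rfl⟩
  · refine mem_of_commute_elt_flatten hred hnormal hsep (fun w hw => ⟨root w, hroot w hw, ?_⟩)
      (fun a _ ha => ?_) (Subgroup.mem_centralizer_singleton_iff.1 hg).symm
    · exact Subgroup.subset_closure ⟨_, List.mem_append_left _ (List.mem_map_of_mem hw), rfl⟩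
    · refine Subgroup.subset_closure ⟨[(a, true)], List.mem_append_right _ ?_, rfl⟩
      exact List.mem_map.2 ⟨a, (hgs a).2 ha, rfl⟩

/-! ### Borders and periods -/

/-- The prefix of length `q` of the sequence `s` has a proper border of length `k`. -/
def IsBorder {α : Type*} (s : ℕ → α) (q k : ℕ) : Prop := k < q ∧ ∀ i < k, s i = s (q - k + i)

/-- The longest proper border of the prefix of length `q` has length `k`. -/
def IsMaxBorder {α : Type*} (s : ℕ → α) (q k : ℕ) : Prop :=
  IsBorder s q k ∧ ∀ j, IsBorder s q j → j ≤ k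

/-- The state of the search for the longest border of the prefix of length `q + 1`: its nonempty
borders extend borders of length at most `k` of the prefix of length `q`, and there is one of
length `k`. -/
def IsCandidate {α : Type*} (s : ℕ → α) (q k : ℕ) : Prop :=
  IsBorder s q k ∧ ∀ j, IsBorder s (q + 1) j → j ≤ k + 1

section Border

variable {α : Type*} {s : ℕ → α} {q k j : ℕ}

theorem isMaxBorder_one (s : ℕ → α) : IsMaxBorder s 1 0 :=
  ⟨⟨one_pos, by simp⟩, fun _ h => Nat.lt_succ_iff.1 h.1⟩

theorem IsBorder.trans (h : IsBorder s q k) (h' : IsBorder s k j) : IsBorder s q j := by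
  have := h.1
  have := h'.1
  refine ⟨by omega, fun i hi => ?_⟩
  rw [h'.2 i hi, h.2 (k - j + i) (by omega)]
  congr 1; omega

theorem IsBorder.of_lt (h : IsBorder s q k) (h' : IsBorder s q j) (hjk : j < k) :
    IsBorder s k j := by
  have := h.1
  refine ⟨hjk, fun i hi => ?_⟩
  rw [h'.2 i hi, h.2 (k - j + i) (by omega)]
  congr 1; omega

theorem isBorder_succ_succ_iff : IsBorder s (q + 1) (j + 1) ↔ IsBorder s q j ∧ s j = s q := by
  have hsub (hj : j < q) (i : ℕ) : q + 1 - (j + 1) + i = q - j + i := by omega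
  constructor
  · rintro ⟨hj, h⟩
    have hj : j < q := by omega
    refine ⟨⟨hj, fun i hi => (h i (by omega)).trans (congrArg s (hsub hj i))⟩, ?_⟩
    exact (h j (by omega)).trans (congrArg s (by omega))
  · rintro ⟨⟨hj, h⟩, hjq⟩
    refine ⟨by omega, fun i hi => ?_⟩
    rw [hsub hj]
    rcases Nat.lt_succ_iff_lt_or_eq.1 hi with hi | rfl
    · exact h i hi
    · exact hjq.trans (congrArg s (by omega))

theorem IsMaxBorder.isCandidate (h : IsMaxBorder s q k) : IsCandidate s q k := by
  refine ⟨h.1, fun j hj => ?_⟩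
  rcases j with _ | j
  · exact Nat.zero_le _
  · exact Nat.succ_le_succ (h.2 j (isBorder_succ_succ_iff.1 hj).1)

theorem IsCandidate.succ_of_eq (h : IsCandidate s q k) (hs : s k = s q) :
    IsMaxBorder s (q + 1) (k + 1) := ⟨isBorder_succ_succ_iff.2 ⟨h.1, hs⟩, h.2⟩

theorem IsCandidate.zero_of_ne (h : IsCandidate s q 0) (hs : s 0 ≠ s q) :
    IsMaxBorder s (q + 1) 0 := by
  refine ⟨⟨q.succ_pos, by simp⟩, fun j hj => ?_⟩
  rcases j with _ | j
  · exact le_rfl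
  · obtain rfl : j = 0 := Nat.le_zero.1 (Nat.le_of_succ_le_succ (h.2 _ hj))
    exact absurd (isBorder_succ_succ_iff.1 hj).2 hs

theorem IsCandidate.fallback (h : IsCandidate s q k) (hs : s k ≠ s q) (hj : IsMaxBorder s k j) :
    IsCandidate s q j := by
  refine ⟨h.1.trans hj.1, fun i hi => ?_⟩
  rcases i with _ | i
  · exact Nat.zero_le _
  · obtain ⟨hiq, his⟩ := isBorder_succ_succ_iff.1 hi
    have hik : i ≠ k := by
      rintro rfl
      exact hs his
    have hle := h.2 _ hi
    exact Nat.succ_le_succ (hj.2 i (h.1.of_lt hiq (by omega)))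

end Border

theorem hasPeriod_wordPow (z : Word N) (r : ℕ) : (wordPow z r).HasPeriod z.length := by
  rcases r with _ | r
  · exact List.hasPeriod_empty _
  · rw [List.HasPeriod, wordPow_succ, List.take_left, List.prefix_append_right_inj,
      append_comm_wordPow rfl]
    exact List.prefix_append _ _

theorem eq_wordPow_of_hasPeriod {w : Word N} {p r : ℕ} (hw : w.HasPeriod p)
    (hlen : w.length = r * p) : w = wordPow (w.take p) r := by
  have hprefix : ∀ n, w <+: wordPow (w.take p) n ++ w := by
    intro n
    induction n with
    | zero => exact List.prefix_rfl
    | succ n ih =>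
      rw [wordPow_succ, List.append_assoc]
      exact hw.trans ((List.prefix_append_right_inj _).2 ih)
  have hlen' : (wordPow (w.take p) r).length = w.length := by
    rcases r with _ | r
    · rw [hlen, wordPow_zero, List.length_nil, zero_mul]
    · rw [length_wordPow, List.length_take_of_le (hlen ▸ Nat.le_mul_of_pos_left p r.succ_pos), hlen]
  exact (List.prefix_of_prefix_length_le (hprefix r) (List.prefix_append _ _)
    hlen'.ge).eq_of_length hlen'.symm

/-- The codes of the letters of a word, as a sequence that is `0` beyond the end of the word. -/
def letterAt (w : Word N) (i : ℕ) : ℕ := (w.map letterCode).getD i 0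

theorem letterCode_injective : Function.Injective (letterCode (N := N)) := by
  rintro ⟨a, ε⟩ ⟨b, δ⟩ h
  simp only [letterCode] at h
  have hab : a = b := by
    apply Fin.ext
    split_ifs at h <;> omega
  subst hab
  cases ε <;> cases δ <;> simp_all

theorem letterAt_eq_iff {w : Word N} {i j : ℕ} (hi : i < w.length) (hj : j < w.length) :
    letterAt w i = letterAt w j ↔ w[i]? = w[j]? := by
  simp [letterAt, hi, hj, letterCode_injective.eq_iff]

theorem isBorder_letterAt_iff {w : Word N} {k : ℕ} (hk : k < w.length) :
    IsBorder (letterAt w) w.length k ↔ w.HasPeriod (w.length - k) := by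
  rw [List.hasPeriod_iff_getElem?, IsBorder, Nat.sub_sub_self hk.le, and_iff_right hk]
  refine forall₂_congr fun i hi => ?_
  rw [letterAt_eq_iff (by omega) (by omega), Nat.add_comm]

theorem IsMaxBorder.sub_le_of_hasPeriod {w : Word N} {k p : ℕ}
    (hk : IsMaxBorder (letterAt w) w.length k) (hp0 : 0 < p) (hp : w.HasPeriod p) :
    w.length - k ≤ p := by
  rcases le_or_gt w.length p with hlt | hlt
  · omega
  · have := hk.2 (w.length - p) ((isBorder_letterAt_iff (by omega)).2
      (by rwa [Nat.sub_sub_self hlt.le]))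
    omega

/-- The length of the root of a word of length `n` with longest proper border of length `k`: the
smallest period `n - k` if it divides `n`. -/
def rootLength (n k : ℕ) : ℕ := if n - k ∣ n then n - k else n

theorem isWordRoot_take {w : Word N} {k : ℕ} (hk : IsMaxBorder (letterAt w) w.length k) :
    IsWordRoot w (w.take (rootLength w.length k)) := by
  have hkw := hk.1.1
  have hperiod := (isBorder_letterAt_iff hkw).1 hk.1
  have hpow {z : Word N} {r : ℕ} (hz : w = wordPow z r) :
      w.length = r * z.length ∧ w.HasPeriod z.length ∧ w.length - k ≤ z.length := by
    have hlen : w.length = r * z.length := by rw [hz, length_wordPow]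
    have hper : w.HasPeriod z.length := hz ▸ hasPeriod_wordPow z r
    have hpos : 0 < r * z.length := by omega
    exact ⟨hlen, hper, hk.sub_le_of_hasPeriod (Nat.pos_of_mul_pos_left hpos) hper⟩
  rw [rootLength]
  split_ifs with hdvd
  · obtain ⟨r, hr⟩ := hdvd
    refine ⟨r, eq_wordPow_of_hasPeriod hperiod (by rwa [mul_comm]), fun z s hz => ?_⟩
    obtain ⟨hlen, -, hle⟩ := hpow hz
    refine Nat.le_of_mul_le_mul_left (c := w.length - k) ?_ (by omega)
    calc (w.length - k) * s ≤ z.length * s := Nat.mul_le_mul_right s hle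
      _ = (w.length - k) * r := by rw [← hr, hlen, mul_comm]
  · refine ⟨1, by rw [List.take_length, wordPow_one], fun z s hz => ?_⟩
    obtain ⟨hlen, hper, hle⟩ := hpow hz
    by_contra! hs
    -- By Fine and Wilf, the smallest period divides `|z|`.
    have hsum : w.length - k + z.length ≤ w.length := by nlinarith
    have hgcd := hk.sub_le_of_hasPeriod (Nat.gcd_pos_of_pos_left z.length (by omega))
      (hperiod.gcd hper (by omega))
    have hdvd' : w.length - k ∣ z.length :=
      (le_antisymm hgcd (Nat.gcd_le_left _ (by omega))) ▸ Nat.gcd_dvd_right _ _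
    exact hdvd (hlen ▸ hdvd'.mul_left s)

end RAAG

namespace RAM

/-! ### Reasoning about programs -/

/-- The instructions of the program `P` from position `pc` on begin with the block `Q`. -/
def CodeAt (P : Program) (pc : ℕ) (Q : Program) : Prop :=
  ∀ j I, Q[j]? = some I → P[pc + j]? = some I

/-- All registers hold numbers of size at most `B`. -/
def Bdd (B : ℕ) (m : ℕ → ℕ) : Prop := ∀ r, m r ≤ B

/-- The program leads from one configuration to another within `T` steps, with all registers
bounded by `B` on the way. -/
inductive Reach (P : Program) (B : ℕ) : ℕ → Config → Config → Prop
  | refl {T : ℕ} {c : Config} (hb : Bdd B c.mem) : Reach P B T c c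
  | head {T : ℕ} {c c' d : Config} (hb : Bdd B c.mem) (hs : step P c = some c')
      (h : Reach P B T c' d) : Reach P B (T + 1) c d

variable {P Q R : Program} {B T T' pc : ℕ} {m : ℕ → ℕ} {i o : List ℕ} {c d e : Config} {I : Instr}

theorem codeAt_append_zero (Q R : Program) : CodeAt (Q ++ R) 0 Q := fun j I h => by
  rw [Nat.zero_add, List.getElem?_append_left (List.getElem?_eq_some_iff.1 h).1, h]

theorem CodeAt.head (h : CodeAt P pc (I :: Q)) : P[pc]? = some I := h 0 I rfl

theorem CodeAt.append_right (h : CodeAt P pc (Q ++ R)) : CodeAt P (pc + Q.length) R :=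
  fun j I hj => by
    rw [Nat.add_assoc]
    exact h _ I (by rwa [List.getElem?_append_right (Nat.le_add_right _ _),
      Nat.add_sub_cancel_left])

theorem CodeAt.append_left (h : CodeAt P pc (Q ++ R)) : CodeAt P pc Q := fun j I hj =>
  h j I (by rwa [List.getElem?_append_left (List.getElem?_eq_some_iff.1 hj).1])

theorem CodeAt.tail (h : CodeAt P pc (I :: Q)) : CodeAt P (pc + 1) Q :=
  CodeAt.append_right (Q := [I]) h

theorem Bdd.update (h : Bdd B m) (a : ℕ) {v : ℕ} (hv : v ≤ B) : Bdd B (Function.update m a v) :=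
  fun r => by
    rw [Function.update_apply]
    split_ifs
    · exact hv
    · exact h r

theorem Reach.mono (h : Reach P B T c d) (hT : T ≤ T') : Reach P B T' c d := by
  induction h generalizing T' with
  | refl hb => exact .refl hb
  | head hb hs _ ih =>
    obtain ⟨T', rfl⟩ := Nat.exists_eq_add_of_le' (Nat.one_le_of_lt hT)
    exact .head hb hs (ih (by omega))

theorem Reach.trans (h : Reach P B T c d) (h' : Reach P B T' d e) : Reach P B (T + T') c e := by
  induction h with
  | refl _ => exact h'.mono (by omega)
  | head hb hs _ ih => exact (Reach.head hb hs (ih h')).mono (by omega)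

theorem Reach.bdd (h : Reach P B T c ⟨pc, m, i, o⟩) : Bdd B m := by
  generalize hd : Config.mk pc m i o = d at h
  induction h with
  | refl hb =>
    subst hd
    exact hb
  | head _ _ _ ih => exact ih hd

theorem Reach.exists_run (h : Reach P B T c d) : ∃ t ≤ T, Run P t c d := by
  induction h with
  | refl => exact ⟨0, Nat.zero_le _, rfl⟩
  | head _ hs _ ih =>
    obtain ⟨t, ht, hr⟩ := ih
    exact ⟨t + 1, Nat.succ_le_succ ht, _, hs, hr⟩

theorem Reach.bdd_of_run (h : Reach P B T c d) (hd : step P d = none) {t : ℕ} (hr : Run P t c e) :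
    Bdd B e.mem := by
  induction h generalizing t with
  | refl hb =>
    rcases t with _ | t
    · exact (show _ = e from hr) ▸ hb
    · obtain ⟨c', hs, -⟩ := hr
      exact absurd (hd.symm.trans hs) nofun
  | head hb hs _ ih =>
    rcases t with _ | t
    · exact (show _ = e from hr) ▸ hb
    · obtain ⟨c', hs', hr⟩ := hr
      obtain rfl := Option.some_inj.1 (hs.symm.trans hs')
      exact ih hd hr

theorem Reach.computesWithin (h : Reach P B T (init i) d) (hd : step P d = none) :
    ComputesWithin P i d.output T B := by
  obtain ⟨t, ht, hr⟩ := h.exists_run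
  exact ⟨⟨t, ht, d, hr, hd, rfl⟩, fun _ _ hr => h.bdd_of_run hd hr⟩

theorem val_imm {n : ℕ} : (Config.mk pc m i o).val (.imm n) = n := rfl

theorem val_reg {r u : ℕ} (h : m r = u) : (Config.mk pc m i o).val (.reg r) = u := h

theorem val_ind {r a u : ℕ} (h : m r = a) (h' : m a = u) :
    (Config.mk pc m i o).val (.ind r) = u := by
  subst h
  exact h'

theorem addr_reg {r : ℕ} : (Config.mk pc m i o).addr (.reg r) = r := rfl

theorem addr_ind {r a : ℕ} (h : m r = a) : (Config.mk pc m i o).addr (.ind r) = a := h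

theorem Reach.mov {t : Target} {x : Source} {a u : ℕ} (hP : P[pc]? = some (.mov t x))
    (hb : Bdd B m) (ha : (Config.mk pc m i o).addr t = a) (hx : (Config.mk pc m i o).val x = u)
    (hu : u ≤ B)
    (h : Bdd B (Function.update m a u) → Reach P B T ⟨pc + 1, Function.update m a u, i, o⟩ e) :
    Reach P B (T + 1) ⟨pc, m, i, o⟩ e := by
  subst ha hx
  exact .head hb (by rw [step, hP]; rfl) (h (hb.update _ hu))

theorem Reach.add {t : Target} {x y : Source} {a u v : ℕ} (hP : P[pc]? = some (.add t x y))
    (hb : Bdd B m) (ha : (Config.mk pc m i o).addr t = a) (hx : (Config.mk pc m i o).val x = u)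
    (hy : (Config.mk pc m i o).val y = v) (hu : u + v ≤ B)
    (h : Bdd B (Function.update m a (u + v)) →
      Reach P B T ⟨pc + 1, Function.update m a (u + v), i, o⟩ e) :
    Reach P B (T + 1) ⟨pc, m, i, o⟩ e := by
  subst ha hx hy
  exact .head hb (by rw [step, hP]; rfl) (h (hb.update _ hu))

theorem Reach.sub {t : Target} {x y : Source} {a u v : ℕ} (hP : P[pc]? = some (.sub t x y))
    (hb : Bdd B m) (ha : (Config.mk pc m i o).addr t = a) (hx : (Config.mk pc m i o).val x = u)
    (hy : (Config.mk pc m i o).val y = v) (hu : u - v ≤ B)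
    (h : Bdd B (Function.update m a (u - v)) →
      Reach P B T ⟨pc + 1, Function.update m a (u - v), i, o⟩ e) :
    Reach P B (T + 1) ⟨pc, m, i, o⟩ e := by
  subst ha hx hy
  exact .head hb (by rw [step, hP]; rfl) (h (hb.update _ hu))

theorem Reach.jz {x : Source} {u k : ℕ} (hP : P[pc]? = some (.jz x k)) (hb : Bdd B m)
    (hx : (Config.mk pc m i o).val x = u) (hu : u = 0) (h : Reach P B T ⟨k, m, i, o⟩ e) :
    Reach P B (T + 1) ⟨pc, m, i, o⟩ e := by
  refine .head hb ?_ h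
  rw [step, hP]
  simp only [Option.bind_some, exec, hx, hu, if_true]

theorem Reach.jz_of_ne {x : Source} {u k : ℕ} (hP : P[pc]? = some (.jz x k)) (hb : Bdd B m)
    (hx : (Config.mk pc m i o).val x = u) (hu : u ≠ 0) (h : Reach P B T ⟨pc + 1, m, i, o⟩ e) :
    Reach P B (T + 1) ⟨pc, m, i, o⟩ e := by
  refine .head hb ?_ h
  rw [step, hP]
  simp only [Option.bind_some, exec, hx, hu, if_false]

theorem Reach.jump {k : ℕ} (hP : P[pc]? = some (.jz (.imm 0) k)) (hb : Bdd B m)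
    (h : Reach P B T ⟨k, m, i, o⟩ e) : Reach P B (T + 1) ⟨pc, m, i, o⟩ e :=
  .jz hP hb rfl rfl h

theorem Reach.read {t : Target} {a x : ℕ} (hP : P[pc]? = some (.read t)) (hb : Bdd B m)
    (ha : (Config.mk pc m (x :: i) o).addr t = a) (hu : x ≤ B)
    (h : Bdd B (Function.update m a x) → Reach P B T ⟨pc + 1, Function.update m a x, i, o⟩ e) :
    Reach P B (T + 1) ⟨pc, m, x :: i, o⟩ e := by
  subst ha
  exact .head hb (by rw [step, hP]; rfl) (h (hb.update _ hu))

theorem Reach.write {x : Source} {u : ℕ} (hP : P[pc]? = some (.write x)) (hb : Bdd B m)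
    (hx : (Config.mk pc m i o).val x = u) (h : Reach P B T ⟨pc + 1, m, i, o ++ [u]⟩ e) :
    Reach P B (T + 1) ⟨pc, m, i, o⟩ e := by
  subst hx
  exact .head hb (by rw [step, hP]; rfl) h

end RAM

namespace RAAG

open RAM

/-! ### Computing the root of a word -/

/-- Reading the words and writing their roots. Registers below `D` flag the letters that have been
read. The letters of the current word are stored in the registers `D + 6 + 2 * i`, and pointers to
the longest borders of its prefixes in the registers `D + 7 + 2 * i`. -/
def rootProgram (D : ℕ) : Program :=
  [ -- read the first letter of the next word
    .read (.reg (D + 2)),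
    .jz (.reg (D + 2)) 43,
    .mov (.reg D) (.imm (D + 6)),
    .mov (.ind D) (.reg (D + 2)),
    .mov (.ind (D + 2)) (.imm 1),
    .mov (.reg (D + 1)) (.imm (D + 6)),
    .jz (.imm 0) 22,
    -- 7: read the next letter
    .read (.reg (D + 2)),
    .sub (.reg (D + 3)) (.reg (D + 2)) (.imm 1),
    .jz (.reg (D + 3)) 26,
    .mov (.ind D) (.reg (D + 2)),
    .mov (.ind (D + 2)) (.imm 1),
    -- 12: compare it with the letter after the current border
    .sub (.reg (D + 3)) (.ind (D + 1)) (.reg (D + 2)),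
    .sub (.reg (D + 4)) (.reg (D + 2)) (.ind (D + 1)),
    .add (.reg (D + 3)) (.reg (D + 3)) (.reg (D + 4)),
    .jz (.reg (D + 3)) 21,
    .sub (.reg (D + 3)) (.reg (D + 1)) (.imm (D + 6)),
    .jz (.reg (D + 3)) 22,
    .add (.reg (D + 5)) (.reg (D + 1)) (.imm 1),
    .mov (.reg (D + 1)) (.ind (D + 5)),
    .jz (.imm 0) 12,
    -- 21: extend the border
    .add (.reg (D + 1)) (.reg (D + 1)) (.imm 2),
    -- 22: record the border
    .add (.reg D) (.reg D) (.imm 2),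
    .add (.reg (D + 5)) (.reg D) (.imm 1),
    .mov (.ind (D + 5)) (.reg (D + 1)),
    .jz (.imm 0) 7,
    -- 26: end of the word; test whether its smallest period divides its length
    .sub (.reg (D + 3)) (.reg D) (.reg (D + 1)),
    .sub (.reg (D + 4)) (.reg D) (.imm (D + 6)),
    .jz (.reg (D + 4)) 35,
    .sub (.reg (D + 5)) (.reg (D + 3)) (.reg (D + 4)),
    .jz (.reg (D + 5)) 33,
    .sub (.reg (D + 3)) (.reg D) (.imm (D + 6)),
    .jz (.imm 0) 35,
    .sub (.reg (D + 4)) (.reg (D + 4)) (.reg (D + 3)),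
    .jz (.imm 0) 28,
    -- 35: write the root
    .mov (.reg (D + 5)) (.imm (D + 6)),
    .jz (.reg (D + 3)) 41,
    .write (.ind (D + 5)),
    .add (.reg (D + 5)) (.reg (D + 5)) (.imm 2),
    .sub (.reg (D + 3)) (.reg (D + 3)) (.imm 2),
    .jz (.imm 0) 36,
    .write (.imm 1),
    .jz (.imm 0) 0 ]

/-- The registers `c` with `2 ≤ c < D` that are not zero are the members of `L`. -/
def Flagged (D : ℕ) (L : List ℕ) (m : ℕ → ℕ) : Prop := ∀ c, 2 ≤ c → c < D → (m c = 0 ↔ c ∉ L)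

/-- The contents of the registers after reading `q` letters of the word `s` with a border of
length `k`; the letters in `L` have been flagged. -/
structure Stored (D : ℕ) (s : ℕ → ℕ) (L : List ℕ) (q k : ℕ) (m : ℕ → ℕ) : Prop where
  pos : m D = D + 6 + 2 * q
  border : m (D + 1) = D + 6 + 2 * k
  letter : ∀ j < q, m (D + 6 + 2 * j) = s j
  failure : ∀ j, 1 ≤ j → j ≤ q → ∃ b, IsMaxBorder s j b ∧ m (D + 7 + 2 * j) = D + 6 + 2 * b
  flagged : Flagged D L m

/-- The contents of the registers while the letter after the first `q` ones is compared with the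
letter after the current border. -/
structure Comparing (D : ℕ) (s : ℕ → ℕ) (L : List ℕ) (q k : ℕ) (m : ℕ → ℕ) : Prop
    extends Stored D s L q k m where
  last : m (D + 6 + 2 * q) = s q
  current : m (D + 2) = s q

/-- The contents `m'` of the registers agree with `m` except in the auxiliary registers `D + 3`,
`D + 4` and `D + 5`. -/
def SameData (D : ℕ) (m m' : ℕ → ℕ) : Prop := ∀ r, r < D + 3 ∨ D + 5 < r → m' r = m r

variable {P : Program} {B D : ℕ} {m m' m'' s : ℕ → ℕ} {i o L : List ℕ} {q k : ℕ}

theorem Flagged.congr (h : Flagged D L m) (hm : ∀ c, 2 ≤ c → c < D → m' c = m c) :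
    Flagged D L m' := fun c hc hcD => by rw [hm c hc hcD, h c hc hcD]

theorem Flagged.concat (h : Flagged D L m) (x : ℕ) :
    Flagged D (L ++ [x]) (Function.update m x 1) := fun c hc hcD => by
  rcases eq_or_ne c x with rfl | hcx
  · simp
  · rw [Function.update_of_ne hcx, h c hc hcD, List.mem_append, List.mem_singleton,
      or_iff_left hcx]

theorem SameData.refl (D : ℕ) (m : ℕ → ℕ) : SameData D m m := fun _ _ => rfl

theorem SameData.trans (h : SameData D m m') (h' : SameData D m' m'') : SameData D m m'' :=
  fun r hr => (h' r hr).trans (h r hr)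

theorem SameData.update (h : SameData D m m') {r : ℕ} (hr : D + 3 ≤ r ∧ r ≤ D + 5) (x : ℕ) :
    SameData D m (Function.update m' r x) := fun r' hr' => by
  rw [Function.update_of_ne (by omega), h r' hr']

theorem Stored.of_eq (h : Stored D s L q k m)
    (hm : ∀ r, r < D + 2 ∨ D + 5 < r → m' r = m r) : Stored D s L q k m' where
  pos := by rw [hm _ (by omega), h.pos]
  border := by rw [hm _ (by omega), h.border]
  letter j hj := by rw [hm _ (by omega), h.letter j hj]
  failure j hj hj' := by
    rw [hm _ (by omega)]
    exact h.failure j hj hj'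
  flagged := h.flagged.congr fun c _ hc => hm c (by omega)

theorem Stored.congr (h : Stored D s L q k m) (hm : SameData D m m') : Stored D s L q k m' :=
  h.of_eq fun r hr => hm r (by omega)

theorem Comparing.congr (h : Comparing D s L q k m) (hm : SameData D m m') :
    Comparing D s L q k m' where
  toStored := h.toStored.congr hm
  last := by rw [hm _ (by omega), h.last]
  current := by rw [hm _ (by omega), h.current]

theorem Comparing.update_border (h : Comparing D s L q k m) (j : ℕ) :
    Comparing D s L q j (Function.update m (D + 1) (D + 6 + 2 * j)) where
  pos := by rw [Function.update_of_ne (by omega), h.pos]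
  border := Function.update_self ..
  letter a ha := by rw [Function.update_of_ne (by omega), h.letter a ha]
  failure a ha ha' := by
    rw [Function.update_of_ne (by omega)]
    exact h.failure a ha ha'
  flagged := h.flagged.congr fun c _ _ => Function.update_of_ne (by omega) ..
  last := by rw [Function.update_of_ne (by omega), h.last]
  current := by rw [Function.update_of_ne (by omega), h.current]

theorem Stored.store (h : Stored D s L q k m) (hcurrent : m (D + 2) = s q) (hs : s q < D) :
    Comparing D s (L ++ [s q]) q k
      (Function.update (Function.update m (D + 6 + 2 * q) (s q)) (s q) 1) where
  pos := by simp (disch := omega) only [Function.update_of_ne, h.pos]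
  border := by simp (disch := omega) only [Function.update_of_ne, h.border]
  letter j hj := by simp (disch := omega) only [Function.update_of_ne, h.letter j hj]
  failure j hj hj' := by
    simp (disch := omega) only [Function.update_of_ne]
    exact h.failure j hj hj'
  flagged := (h.flagged.congr fun c _ _ => Function.update_of_ne (by omega) ..).concat _
  last := by simp (disch := omega) only [Function.update_of_ne, Function.update_self]
  current := by simp (disch := omega) only [Function.update_of_ne, hcurrent]

theorem Comparing.record (h : Comparing D s L q k m) (hk : IsMaxBorder s (q + 1) k) (x : ℕ) :
    Stored D s L (q + 1) k (Function.update (Function.update (Function.update m D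
      (D + 6 + 2 * q + 2)) (D + 5) x) (D + 6 + 2 * q + 2 + 1) (D + 6 + 2 * k)) where
  pos := by
    simp (disch := omega) only [Function.update_of_ne, Function.update_self]
    ring
  border := by simp (disch := omega) only [Function.update_of_ne, h.border]
  letter j hj := by
    simp (disch := omega) only [Function.update_of_ne]
    rcases Nat.lt_succ_iff_lt_or_eq.1 hj with hj | rfl
    · exact h.letter j hj
    · exact h.last
  failure j hj hj' := by
    rcases Nat.le_succ_iff.1 hj' with hj' | rfl
    · simp (disch := omega) only [Function.update_of_ne]
      exact h.failure j hj hj'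
    · refine ⟨k, hk, ?_⟩
      rw [show D + 7 + 2 * (q + 1) = D + 6 + 2 * q + 2 + 1 by ring, Function.update_self]
  flagged := h.flagged.congr fun c _ _ => by simp (disch := omega) only [Function.update_of_ne]

theorem compare_letters (hP : CodeAt P 0 (rootProgram D)) (hm : Bdd B m)
    (h : Comparing D s L q k m) (hkq : k < q) :
    ∃ m', SameData D m m' ∧ m' (D + 3) = (s k - s q) + (s q - s k) ∧
      Reach P B 3 ⟨12, m, i, o⟩ ⟨15, m', i, o⟩ := by
  have hq : s q ≤ B := h.last ▸ hm _
  have hk : s k ≤ B := h.letter k hkq ▸ hm _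
  refine ⟨_, (((SameData.refl D m).update (r := D + 3) (by omega) (s k - s q)).update
      (r := D + 4) (by omega) (s q - s k)).update (by omega) _, Function.update_self .., ?_⟩
  exact .sub (hP 12 _ rfl) hm addr_reg (val_ind h.border (h.letter k hkq)) (val_reg h.current)
      (by omega) fun hb =>
    .sub (hP 13 _ rfl) hb addr_reg
      (val_reg (by simp (disch := omega) only [Function.update_of_ne, h.current]))
      (val_ind (a := D + 6 + 2 * k) (u := s k)
        (by simp (disch := omega) only [Function.update_of_ne, h.border])
        (by simp (disch := omega) only [Function.update_of_ne, h.letter k hkq])) (by omega)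
      fun hb =>
    .add (hP 14 _ rfl) hb addr_reg
      (val_reg (by simp (disch := omega) only [Function.update_of_ne, Function.update_self]))
      (val_reg (Function.update_self ..)) (by omega) fun hb => .refl hb

theorem extend_border (hP : CodeAt P 0 (rootProgram D)) (hq : D + 2 * q + 20 ≤ B) (hm : Bdd B m)
    (h : Comparing D s L q k m) (hkq : k < q) (h3 : m (D + 3) = 0) :
    ∃ m', Comparing D s L q (k + 1) m' ∧ Reach P B 2 ⟨15, m, i, o⟩ ⟨22, m', i, o⟩ :=
  ⟨_, h.update_border (k + 1), .jz (hP 15 _ rfl) hm (val_reg h3) rfl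
    (.add (hP 21 _ rfl) hm addr_reg (val_reg h.border) val_imm (by omega) fun hb => .refl hb)⟩

theorem test_border (hP : CodeAt P 0 (rootProgram D)) (hm : Bdd B m)
    (h : Comparing D s L q k m) (h3 : m (D + 3) ≠ 0) :
    ∃ m', SameData D m m' ∧ m' (D + 3) = 2 * k ∧
      Reach P B 2 ⟨15, m, i, o⟩ ⟨17, m', i, o⟩ := by
  have hk : D + 6 + 2 * k ≤ B := h.border ▸ hm _
  refine ⟨_, (SameData.refl D m).update (r := D + 3) (by omega) (D + 6 + 2 * k - (D + 6)), ?_,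
    .jz_of_ne (hP 15 _ rfl) hm (val_reg rfl) h3
      (.sub (hP 16 _ rfl) hm addr_reg (val_reg h.border) val_imm (by omega) fun hb => .refl hb)⟩
  rw [Function.update_self]
  omega

theorem shorten_border (hP : CodeAt P 0 (rootProgram D)) (hq : D + 2 * q + 20 ≤ B) (hm : Bdd B m)
    (h : Comparing D s L q k m) (hkq : k < q) (hk0 : 0 < k) (h3 : m (D + 3) = 2 * k) :
    ∃ j m', IsMaxBorder s k j ∧ Comparing D s L q j m' ∧
      Reach P B 4 ⟨17, m, i, o⟩ ⟨12, m', i, o⟩ := by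
  obtain ⟨j, hj, hmj⟩ := h.failure k hk0 hkq.le
  have hjk := hj.1.1
  refine ⟨j, _, hj, (h.congr ((SameData.refl D m).update (r := D + 5) (by omega)
    (D + 6 + 2 * k + 1))).update_border j, ?_⟩
  exact .jz_of_ne (hP 17 _ rfl) hm (val_reg h3) (by omega)
    (.add (hP 18 _ rfl) hm addr_reg (val_reg h.border) val_imm (by omega) fun hb =>
    .mov (hP 19 _ rfl) hb addr_reg (val_ind (a := D + 6 + 2 * k + 1) (Function.update_self ..)
      (by rw [Function.update_of_ne (by omega), ← hmj]; congr 1; omega)) (by omega) fun hb =>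
    .jump (hP 20 _ rfl) hb (.refl hb))

theorem compare_loop (hP : CodeAt P 0 (rootProgram D)) (hq : D + 2 * q + 20 ≤ B) (hm : Bdd B m)
    (h : Comparing D s L q k m) (hk : IsCandidate s q k) :
    ∃ k' m', k' ≤ k + 1 ∧ IsMaxBorder s (q + 1) k' ∧ Comparing D s L q k' m' ∧
      Reach P B (9 * (k + 1 - k') + 6) ⟨12, m, i, o⟩ ⟨22, m', i, o⟩ := by
  induction k using Nat.strong_induction_on generalizing m with
  | _ k ih =>
    have hkq := hk.1.1
    obtain ⟨m₁, hm₁, hdiff, hR₁⟩ := compare_letters (i := i) (o := o) hP hm h hkq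
    have h₁ := h.congr hm₁
    by_cases hne : s k = s q
    · obtain ⟨m₂, h₂, hR₂⟩ := extend_border (i := i) (o := o) hP hq hR₁.bdd h₁ hkq (by omega)
      exact ⟨k + 1, m₂, le_rfl, hk.succ_of_eq hne, h₂, (hR₁.trans hR₂).mono (by omega)⟩
    obtain ⟨m₂, hm₂, h3, hR₂⟩ := test_border (i := i) (o := o) hP hR₁.bdd h₁ (by omega)
    have h₂ := h₁.congr hm₂
    rcases Nat.eq_zero_or_pos k with rfl | hk0
    · refine ⟨0, m₂, Nat.zero_le _, hk.zero_of_ne hne, h₂,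
        ((hR₁.trans hR₂).trans (T' := 1) ?_).mono (by omega)⟩
      exact .jz (hP 17 _ rfl) hR₂.bdd (val_reg h3) rfl (.refl hR₂.bdd)
    obtain ⟨j, m₃, hj, h₃, hR₃⟩ :=
      shorten_border (i := i) (o := o) hP hq hR₂.bdd h₂ hkq hk0 h3
    have hjk := hj.1.1
    obtain ⟨k', m', hk', hmax, h', hR'⟩ := ih j hjk hR₃.bdd h₃ (hk.fallback hne hj)
    exact ⟨k', m', by omega, hmax, h', (((hR₁.trans hR₂).trans hR₃).trans hR').mono (by omega)⟩

theorem record_border (hP : CodeAt P 0 (rootProgram D)) (hq : D + 2 * q + 20 ≤ B) (hm : Bdd B m)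
    (h : Comparing D s L q k m) (hk : IsMaxBorder s (q + 1) k) :
    ∃ m', Stored D s L (q + 1) k m' ∧ Reach P B 4 ⟨22, m, i, o⟩ ⟨7, m', i, o⟩ := by
  have hkq := hk.1.1
  refine ⟨_, h.record hk (D + 6 + 2 * q + 2 + 1), ?_⟩
  exact .add (hP 22 _ rfl) hm addr_reg (val_reg h.pos) val_imm (by omega) fun hb =>
    .add (hP 23 _ rfl) hb addr_reg (val_reg (Function.update_self ..)) val_imm (by omega) fun hb =>
    .mov (hP 24 _ rfl) hb (addr_ind (Function.update_self ..))
      (val_reg (by simp (disch := omega) only [Function.update_of_ne, h.border])) (by omega)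
      fun hb =>
    .jump (hP 25 _ rfl) hb (.refl hb)

theorem end_of_word (hP : CodeAt P 0 (rootProgram D)) (hB : 1 ≤ B) (hm : Bdd B m)
    (h : Stored D s L q k m) :
    ∃ m', Stored D s L q k m' ∧ Reach P B 3 ⟨7, m, 1 :: i, o⟩ ⟨26, m', i, o⟩ := by
  refine ⟨Function.update (Function.update m (D + 2) 1) (D + 3) (1 - 1), h.of_eq fun r hr => ?_, ?_⟩
  · simp (disch := omega) only [Function.update_of_ne]
  · exact .read (hP 7 _ rfl) hm addr_reg hB fun hb =>
      .sub (hP 8 _ rfl) hb addr_reg (val_reg (Function.update_self ..)) val_imm (by omega) fun hb =>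
      .jz (hP 9 _ rfl) hb (val_reg (Function.update_self ..)) rfl (.refl hb)

theorem store_letter (hP : CodeAt P 0 (rootProgram D)) (hD : D ≤ B) (hm : Bdd B m)
    (h : Stored D s L q k m) (hs : 2 ≤ s q ∧ s q < D) :
    ∃ m', Comparing D s (L ++ [s q]) q k m' ∧
      Reach P B 5 ⟨7, m, s q :: i, o⟩ ⟨12, m', i, o⟩ := by
  set m₁ := Function.update (Function.update m (D + 2) (s q)) (D + 3) (s q - 1) with hm₁
  have hcurrent : m₁ (D + 2) = s q := by
    simp (disch := omega) only [hm₁, Function.update_of_ne, Function.update_self]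
  have h₁ : Stored D s L q k m₁ := h.of_eq fun r hr => by
    simp (disch := omega) only [hm₁, Function.update_of_ne]
  refine ⟨_, h₁.store hcurrent hs.2, ?_⟩
  exact .read (hP 7 _ rfl) hm addr_reg (by omega) fun hb =>
    .sub (hP 8 _ rfl) hb addr_reg (val_reg (Function.update_self ..)) val_imm (by omega) fun hb =>
    .jz_of_ne (hP 9 _ rfl) hb (val_reg (Function.update_self ..)) (by omega)
    (.mov (hP 10 _ rfl) hb (addr_ind h₁.pos) (val_reg hcurrent) (by omega) fun hb =>
    .mov (hP 11 _ rfl) hb (addr_ind (by rw [Function.update_of_ne (by omega)]; exact hcurrent))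
      val_imm (by omega) fun hb => .refl hb)

theorem read_letter (hP : CodeAt P 0 (rootProgram D)) (hq : D + 2 * q + 20 ≤ B) (hm : Bdd B m)
    (h : Stored D s L q k m) (hs : 2 ≤ s q ∧ s q < D) (hk : IsMaxBorder s q k) :
    ∃ k' m', k' ≤ k + 1 ∧ IsMaxBorder s (q + 1) k' ∧ Stored D s (L ++ [s q]) (q + 1) k' m' ∧
      Reach P B (9 * (k + 1 - k') + 15) ⟨7, m, s q :: i, o⟩ ⟨7, m', i, o⟩ := by
  obtain ⟨m₁, h₁, hR₁⟩ := store_letter (i := i) (o := o) hP (by omega) hm h hs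
  obtain ⟨k', m₂, hle, hk', h₂, hR₂⟩ :=
    compare_loop (i := i) (o := o) hP hq hR₁.bdd h₁ hk.isCandidate
  obtain ⟨m', h', hR'⟩ := record_border (i := i) (o := o) hP hq hR₂.bdd h₂ hk'
  exact ⟨k', m', hle, hk', h', ((hR₁.trans hR₂).trans hR').mono (by omega)⟩

theorem read_loop (hP : CodeAt P 0 (rootProgram D)) {d : ℕ} (hB : D + 2 * (q + d) + 20 ≤ B)
    (hs : ∀ j < q + d, 2 ≤ s j ∧ s j < D) (hm : Bdd B m) (h : Stored D s L q k m)
    (hk : IsMaxBorder s q k) :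
    ∃ k' m', IsMaxBorder s (q + d) k' ∧
      Stored D s (L ++ (List.range' q d).map s) (q + d) k' m' ∧
      Reach P B (9 * k + 24 * d + 3) ⟨7, m, (List.range' q d).map s ++ 1 :: i, o⟩
        ⟨26, m', i, o⟩ := by
  induction d generalizing q k m L with
  | zero =>
    obtain ⟨m', h', hR⟩ := end_of_word (i := i) (o := o) hP (by omega) hm h
    exact ⟨k, m', hk, by simpa using h', hR.mono (by omega)⟩
  | succ d ih =>
    rw [List.range'_succ, List.map_cons, List.cons_append, Nat.add_comm d 1, ← Nat.add_assoc]
    obtain ⟨k₁, m₁, hle, hk₁, h₁, hR₁⟩ := read_letter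
      (i := (List.range' (q + 1) d).map s ++ 1 :: i) (o := o) hP (by omega) hm h
      (hs q (by omega)) hk
    obtain ⟨k', m', hk', h', hR'⟩ :=
      ih (by omega) (fun j hj => hs j (by omega)) hR₁.bdd h₁ hk₁
    -- The border grows by at most one with every letter, which pays for the comparisons.
    refine ⟨k', m', hk', ?_, (hR₁.trans hR').mono (by omega)⟩
    rwa [List.append_assoc, List.singleton_append] at h'

theorem divide_loop (hP : CodeAt P 0 (rootProgram D)) {n p z : ℕ} (hp : 0 < p) (hm : Bdd B m)
    (hpos : m D = D + 6 + 2 * n) (h3 : m (D + 3) = 2 * p) (h4 : m (D + 4) = 2 * z) :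
    ∃ m', SameData D m m' ∧ m' (D + 3) = 2 * (if p ∣ z then p else n) ∧
      Reach P B (5 * z + 5) ⟨28, m, i, o⟩ ⟨35, m', i, o⟩ := by
  induction z using Nat.strong_induction_on generalizing m with
  | _ z ih =>
    have hBp := hm (D + 3)
    have hBz := hm (D + 4)
    have hBn := hm D
    rcases Nat.eq_zero_or_pos z with rfl | hz
    · exact ⟨m, .refl D m, by simpa using h3,
        Reach.mono (T := 1) (.jz (hP 28 _ rfl) hm (val_reg h4) rfl (.refl hm)) (by omega)⟩
    set m₁ := Function.update m (D + 5) (2 * p - 2 * z) with hm₁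
    have hdata₁ : SameData D m m₁ := (SameData.refl D m).update (by omega) _
    have h5 : m₁ (D + 5) = 2 * p - 2 * z := Function.update_self ..
    have hR₁ : Reach P B 2 ⟨28, m, i, o⟩ ⟨30, m₁, i, o⟩ :=
      .jz_of_ne (hP 28 _ rfl) hm (val_reg h4) (by omega)
        (.sub (hP 29 _ rfl) hm addr_reg (val_reg h3) (val_reg h4) (by omega)
          fun hb => .refl hb)
    rcases Nat.lt_or_ge z p with hzp | hzp
    · refine ⟨Function.update m₁ (D + 3) (D + 6 + 2 * n - (D + 6)), hdata₁.update (by omega) _, ?_,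
        (hR₁.trans (T' := 3) ?_).mono (by omega)⟩
      · rw [Function.update_self, if_neg (Nat.not_dvd_of_pos_of_lt hz hzp)]
        omega
      · exact .jz_of_ne (hP 30 _ rfl) hR₁.bdd (val_reg h5) (by omega)
          (.sub (hP 31 _ rfl) hR₁.bdd addr_reg
            (val_reg ((hdata₁ _ (by omega)).trans hpos)) val_imm (by omega)
            fun hb => .jump (hP 32 _ rfl) hb (.refl hb))
    · have hR₂ : Reach P B 3 ⟨30, m₁, i, o⟩
          ⟨28, Function.update m₁ (D + 4) (2 * z - 2 * p), i, o⟩ :=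
        .jz (hP 30 _ rfl) hR₁.bdd (val_reg h5) (by omega)
          (.sub (hP 33 _ rfl) hR₁.bdd addr_reg
            (val_reg (by simp (disch := omega) only [hm₁, Function.update_of_ne, h4]))
            (val_reg (by simp (disch := omega) only [hm₁, Function.update_of_ne, h3]))
            (by omega) fun hb => .jump (hP 34 _ rfl) hb (.refl hb))
      have hdata₂ := hdata₁.update (r := D + 4) (by omega) (2 * z - 2 * p)
      obtain ⟨m', hdata', h3', hR'⟩ := ih (z - p) (by omega) hR₂.bdd
        ((hdata₂ _ (by omega)).trans hpos)
        (by simp (disch := omega) only [hm₁, Function.update_of_ne, h3])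
        (by rw [Function.update_self]; omega)
      refine ⟨m', hdata₂.trans hdata', ?_, ((hR₁.trans hR₂).trans hR').mono (by omega)⟩
      simpa only [Nat.dvd_sub_iff_left hzp dvd_rfl] using h3'

theorem compute_rootLength (hP : CodeAt P 0 (rootProgram D)) {n : ℕ} (hkn : k < n) (hm : Bdd B m)
    (h : Stored D s L n k m) :
    ∃ m', SameData D m m' ∧ m' (D + 3) = 2 * rootLength n k ∧
      Reach P B (5 * n + 7) ⟨26, m, i, o⟩ ⟨35, m', i, o⟩ := by
  have hB : D + 6 + 2 * n ≤ B := h.pos ▸ hm _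
  set m₁ := Function.update (Function.update m (D + 3) (D + 6 + 2 * n - (D + 6 + 2 * k)))
    (D + 4) (D + 6 + 2 * n - (D + 6)) with hm₁
  have hdata₁ : SameData D m m₁ := ((SameData.refl D m).update (by omega) _).update (by omega) _
  have hR₁ : Reach P B 2 ⟨26, m, i, o⟩ ⟨28, m₁, i, o⟩ :=
    .sub (hP 26 _ rfl) hm addr_reg (val_reg h.pos) (val_reg h.border) (by omega) fun hb =>
    .sub (hP 27 _ rfl) hb addr_reg (val_reg (by rw [Function.update_of_ne (by omega), h.pos]))
      val_imm (by omega) fun hb => .refl hb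
  obtain ⟨m', hdata', h3, hR'⟩ := divide_loop (i := i) (o := o) (n := n) (p := n - k) (z := n) hP
    (by omega) hR₁.bdd ((hdata₁ _ (by omega)).trans h.pos)
    (by
      simp (disch := omega) only [hm₁, Function.update_of_ne, Function.update_self]
      omega)
    (by
      rw [hm₁, Function.update_self]
      omega)
  exact ⟨m', hdata₁.trans hdata', h3, (hR₁.trans hR').mono (by omega)⟩

theorem write_loop (hP : CodeAt P 0 (rootProgram D)) {t y : ℕ} (hB : D + 2 * (t + y) + 20 ≤ B)
    (hm : Bdd B m) (hs : ∀ j < t + y, m (D + 6 + 2 * j) = s j) (h3 : m (D + 3) = 2 * y)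
    (h5 : m (D + 5) = D + 6 + 2 * t) :
    ∃ m', SameData D m m' ∧
      Reach P B (5 * y + 1) ⟨36, m, i, o⟩ ⟨41, m', i, o ++ (List.range' t y).map s⟩ := by
  induction y generalizing t m o with
  | zero =>
    refine ⟨m, .refl D m, ?_⟩
    simp only [List.range'_zero, List.map_nil, List.append_nil]
    exact .jz (hP 36 _ rfl) hm (val_reg h3) rfl (.refl hm)
  | succ y ih =>
    set m₁ := Function.update (Function.update m (D + 5) (D + 6 + 2 * t + 2)) (D + 3)
      (2 * (y + 1) - 2) with hm₁
    have hdata : SameData D m m₁ := ((SameData.refl D m).update (by omega) _).update (by omega) _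
    have hR : Reach P B 5 ⟨36, m, i, o⟩ ⟨36, m₁, i, o ++ [s t]⟩ :=
      .jz_of_ne (hP 36 _ rfl) hm (val_reg h3) (by omega)
        (.write (hP 37 _ rfl) hm (val_ind h5 (hs t (by omega)))
        (.add (hP 38 _ rfl) hm addr_reg (val_reg h5) val_imm (by omega) fun hb =>
        .sub (hP 39 _ rfl) hb addr_reg
          (val_reg (by rw [Function.update_of_ne (by omega), h3])) val_imm (by omega) fun hb =>
        .jump (hP 40 _ rfl) hb (.refl hb)))
    obtain ⟨m', hdata', hR'⟩ := ih (t := t + 1) (o := o ++ [s t]) (by omega) hR.bdd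
      (fun j hj => (hdata _ (by omega)).trans (hs j (by omega)))
      (by rw [hm₁, Function.update_self]; omega)
      (by rw [hm₁, Function.update_of_ne (by omega), Function.update_self]; ring)
    refine ⟨m', hdata.trans hdata', ?_⟩
    rw [List.append_assoc, List.singleton_append] at hR'
    rw [List.range'_succ, List.map_cons]
    exact (hR.trans hR').mono (by omega)

theorem write_root (hP : CodeAt P 0 (rootProgram D)) {p : ℕ} (hB : D + 2 * p + 20 ≤ B)
    (hm : Bdd B m) (hs : ∀ j < p, m (D + 6 + 2 * j) = s j) (h3 : m (D + 3) = 2 * p) :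
    ∃ m', SameData D m m' ∧
      Reach P B (5 * p + 4) ⟨35, m, i, o⟩ ⟨0, m', i, o ++ (List.range p).map s ++ [1]⟩ := by
  have hdata₁ : SameData D m (Function.update m (D + 5) (D + 6)) :=
    (SameData.refl D m).update (by omega) _
  have hR₁ : Reach P B 1 ⟨35, m, i, o⟩ ⟨36, Function.update m (D + 5) (D + 6), i, o⟩ :=
    .mov (hP 35 _ rfl) hm addr_reg val_imm (by omega) fun hb => .refl hb
  obtain ⟨m', hdata', hR'⟩ := write_loop (i := i) (o := o) (s := s) (t := 0) (y := p) hP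
    (by omega) hR₁.bdd (fun j hj => (hdata₁ _ (by omega)).trans (hs j (by omega)))
    (by rw [Function.update_of_ne (by omega), h3]) (Function.update_self ..)
  refine ⟨m', hdata₁.trans hdata', ((hR₁.trans hR').trans (T' := 2) ?_).mono (by omega)⟩
  rw [← List.range_eq_range']
  exact .write (hP 41 _ rfl) hR'.bdd val_imm (.jump (hP 42 _ rfl) hR'.bdd (.refl hR'.bdd))

theorem start_word (hP : CodeAt P 0 (rootProgram D)) (hB : D + 20 ≤ B) (hm : Bdd B m)
    (hL : Flagged D L m) (hs : 2 ≤ s 0 ∧ s 0 < D) :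
    ∃ m', Stored D s (L ++ [s 0]) 1 0 m' ∧
      Reach P B 11 ⟨0, m, s 0 :: i, o⟩ ⟨7, m', i, o⟩ := by
  set m₀ := Function.update (Function.update (Function.update m (D + 2) (s 0)) D (D + 6))
    (D + 6) (s 0) with hm₀
  set m₁ := Function.update (Function.update m₀ (s 0) 1) (D + 1) (D + 6) with hm₁
  have hR₁ : Reach P B 7 ⟨0, m, s 0 :: i, o⟩ ⟨22, m₁, i, o⟩ :=
    .read (hP 0 _ rfl) hm addr_reg (by omega) fun hb =>
    .jz_of_ne (hP 1 _ rfl) hb (val_reg (Function.update_self ..)) (by omega)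
    (.mov (hP 2 _ rfl) hb addr_reg val_imm (by omega) fun hb =>
    .mov (hP 3 _ rfl) hb (addr_ind (Function.update_self ..))
      (val_reg (by simp (disch := omega) only [Function.update_of_ne, Function.update_self]))
      (by omega) fun hb =>
    .mov (hP 4 _ rfl) hb (addr_ind (by
      simp (disch := omega) only [Function.update_of_ne, Function.update_self])) val_imm (by omega)
      fun hb =>
    .mov (hP 5 _ rfl) hb addr_reg val_imm (by omega) fun hb => .jump (hP 6 _ rfl) hb (.refl hb))
  have h₁ : Comparing D s (L ++ [s 0]) 0 0 m₁ :=
    { pos := by simp (disch := omega) only [hm₁, hm₀, Function.update_of_ne, Function.update_self]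
      border := Function.update_self ..
      letter := fun j hj => absurd hj (Nat.not_lt_zero j)
      failure := fun j hj hj' => absurd hj' (Nat.not_le_of_lt hj)
      flagged := ((hL.congr fun c _ _ => by
          simp (disch := omega) only [hm₀, Function.update_of_ne]).concat (s 0)).congr
        fun c _ _ => Function.update_of_ne (by omega) ..
      last := by simp (disch := omega) only [hm₁, hm₀, Function.update_of_ne, Function.update_self]
      current := by
        simp (disch := omega) only [hm₁, hm₀, Function.update_of_ne, Function.update_self] }
  obtain ⟨m', h', hR'⟩ := record_border (i := i) (o := o) hP (by omega) hR₁.bdd h₁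
    (isMaxBorder_one s)
  exact ⟨m', h', hR₁.trans hR'⟩

theorem rootLength_le (n k : ℕ) : rootLength n k ≤ n := by
  rw [rootLength]
  split_ifs
  · exact Nat.sub_le n k
  · exact le_rfl

theorem word_loop (hP : CodeAt P 0 (rootProgram D)) {n : ℕ} (hB : D + 2 * n + 20 ≤ B)
    (hn : 0 < n) (hs : ∀ j < n, 2 ≤ s j ∧ s j < D) (hm : Bdd B m) (hL : Flagged D L m) :
    ∃ k m', IsMaxBorder s n k ∧ Flagged D (L ++ (List.range n).map s) m' ∧
      Reach P B (70 * n) ⟨0, m, (List.range n).map s ++ 1 :: i, o⟩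
        ⟨0, m', i, o ++ (List.range (rootLength n k)).map s ++ [1]⟩ := by
  obtain ⟨d, rfl⟩ : ∃ d, n = 1 + d := ⟨n - 1, by omega⟩
  rw [List.range_eq_range', Nat.add_comm, List.range'_succ, List.map_cons, List.cons_append,
    ← List.singleton_append (l := List.map _ _), ← List.append_assoc, Nat.add_comm d]
  obtain ⟨m₁, h₁, hR₁⟩ := start_word (i := (List.range' 1 d).map s ++ 1 :: i) (o := o) hP
    (by omega) hm hL (hs 0 hn)
  obtain ⟨k, m₂, hk, h₂, hR₂⟩ := read_loop (i := i) (o := o) hP (by omega) hs hR₁.bdd h₁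
    (isMaxBorder_one s)
  obtain ⟨m₃, hdata₃, h3, hR₃⟩ := compute_rootLength (i := i) (o := o) hP hk.1.1 hR₂.bdd h₂
  have h₃ := h₂.congr hdata₃
  have hlen := rootLength_le (1 + d) k
  obtain ⟨m₄, hdata₄, hR₄⟩ := write_root (i := i) (o := o) (s := s) hP (by omega) hR₃.bdd
    (fun j hj => h₃.letter j (by omega)) h3
  exact ⟨k, m₄, hk, (h₃.congr hdata₄).flagged,
    (((hR₁.trans hR₂).trans hR₃).trans hR₄).mono (by omega)⟩

theorem isMaxBorder_findGreatest [DecidablePred (IsBorder s q)] (hq : 0 < q) :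
    IsMaxBorder s q (Nat.findGreatest (IsBorder s q) q) :=
  ⟨Nat.findGreatest_spec (P := IsBorder s q) q.zero_le ⟨hq, nofun⟩,
    fun _ hj => Nat.le_findGreatest hj.1.le hj⟩

theorem IsMaxBorder.unique {j : ℕ} (hj : IsMaxBorder s q j) (hk : IsMaxBorder s q k) : j = k :=
  le_antisymm (hk.2 j hj.1) (hj.2 k hk.1)

variable {N : ℕ} {Γ : SimpleGraph (Fin N)}

open Classical in
/-- The shortest word of which `w` is a power, as it is found by the program. -/
noncomputable def root (w : Word N) : Word N :=
  w.take (rootLength w.length (Nat.findGreatest (IsBorder (letterAt w) w.length) w.length))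

theorem isWordRoot_root {w : Word N} (hw : w ≠ []) : IsWordRoot w (root w) := by
  classical
  exact isWordRoot_take (isMaxBorder_findGreatest (List.length_pos_iff.2 hw))

theorem two_le_letterCode (l : Fin N × Bool) : 2 ≤ letterCode l := by
  rw [letterCode]
  split_ifs <;> omega

theorem letterCode_lt (l : Fin N × Bool) : letterCode l < 2 * N + 2 := by
  have := l.1.2
  rw [letterCode]
  split_ifs <;> omega

theorem letterAt_eq {w : Word N} {j : ℕ} (hj : j < w.length) : letterAt w j = letterCode w[j] := by
  simp [letterAt, hj]

theorem map_letterAt_range {w : Word N} {p : ℕ} (hp : p ≤ w.length) :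
    (List.range p).map (letterAt w) = (w.take p).map letterCode := by
  refine List.ext_getElem (by simpa using hp) fun j hj _ => ?_
  have hjp : j < p := by simpa using hj
  simp [letterAt_eq (hjp.trans_le hp)]

theorem process_word (hP : CodeAt P 0 (rootProgram (2 * N + 2))) {w : Word N} (hw : w ≠ [])
    (hB : 2 * N + 2 * w.length + 22 ≤ B) (hm : Bdd B m) (hL : Flagged (2 * N + 2) L m) :
    ∃ m', Flagged (2 * N + 2) (L ++ w.map letterCode) m' ∧
      Reach P B (70 * w.length) ⟨0, m, w.map letterCode ++ 1 :: i, o⟩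
        ⟨0, m', i, o ++ (root w).map letterCode ++ [1]⟩ := by
  classical
  have hlen := List.length_pos_iff.2 hw
  obtain ⟨k, m', hk, hL', hR⟩ := word_loop (i := i) (o := o) (s := letterAt w) hP (by omega) hlen
    (fun j hj => by
      rw [letterAt_eq hj]
      exact ⟨two_le_letterCode _, letterCode_lt _⟩) hm hL
  obtain rfl := hk.unique (isMaxBorder_findGreatest hlen)
  rw [map_letterAt_range le_rfl, List.take_length] at hL' hR
  rw [map_letterAt_range (rootLength_le _ _)] at hR
  exact ⟨m', hL', hR⟩

theorem words_loop (hP : CodeAt P 0 (rootProgram (2 * N + 2))) {ws : List (Word N)}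
    (hne : ∀ w ∈ ws, w ≠ []) (hB : ∀ w ∈ ws, 2 * N + 2 * w.length + 22 ≤ B) (hm : Bdd B m)
    (hL : Flagged (2 * N + 2) L m) :
    ∃ m', Flagged (2 * N + 2) (L ++ ws.flatten.map letterCode) m' ∧
      Reach P B (70 * ws.flatten.length + 2) ⟨0, m, encode ws, o⟩
        ⟨43, m', [], o ++ ws.flatMap fun w => (root w).map letterCode ++ [1]⟩ := by
  induction ws generalizing m L o with
  | nil =>
    refine ⟨Function.update m (2 * N + 2 + 2) 0, ?_, ?_⟩
    · simpa using hL.congr fun c _ _ => Function.update_of_ne (by omega) ..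
    · simp only [encode, List.flatMap_nil, List.nil_append, List.append_nil]
      exact .read (hP 0 _ rfl) hm addr_reg (Nat.zero_le _) fun hb =>
        .jz (hP 1 _ rfl) hb (val_reg (Function.update_self ..)) rfl (.refl hb)
  | cons w ws ih =>
    obtain ⟨hw, hne⟩ := List.forall_mem_cons.1 hne
    obtain ⟨hBw, hB⟩ := List.forall_mem_cons.1 hB
    obtain ⟨m₁, hL₁, hR₁⟩ := process_word (i := encode ws) (o := o) hP hw hBw hm hL
    obtain ⟨m', hL', hR'⟩ := ih (o := o ++ (root w).map letterCode ++ [1]) hne hB hR₁.bdd hL₁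
    have hencode : encode (w :: ws) = w.map letterCode ++ 1 :: encode ws := by simp [encode]
    refine ⟨m', by simpa using hL', ?_⟩
    rw [hencode, List.flatten_cons, List.length_append, List.flatMap_cons]
    simpa only [List.append_assoc] using
      (hR₁.trans hR').mono (show _ ≤ 70 * (w.length + ws.flatten.length) + 2 by omega)

/-! ### The generators that commute with all factors -/

open Classical in
/-- The codes of the letters that do not commute with a generator. -/
noncomputable def neighborCodes (Γ : SimpleGraph (Fin N)) (a : Fin N) : List ℕ :=
  ((List.finRange N).filter fun b => Γ.Adj a b).flatMap
    fun b => [letterCode (b, true), letterCode (b, false)]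

theorem mem_neighborCodes {a : Fin N} {c : ℕ} :
    c ∈ neighborCodes Γ a ↔ ∃ l : Fin N × Bool, Γ.Adj a l.1 ∧ letterCode l = c := by
  simp [neighborCodes, eq_comm, and_or_left, or_comm]

theorem length_neighborCodes_le (a : Fin N) : (neighborCodes Γ a).length ≤ 2 * N := by
  classical
  calc (neighborCodes Γ a).length
      = 2 * ((List.finRange N).filter fun b => Γ.Adj a b).length := by
        simp [neighborCodes, List.length_flatMap, mul_comm]
    _ ≤ 2 * N := Nat.mul_le_mul_left 2
        ((List.length_filter_le _ _).trans_eq List.length_finRange)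

/-- Jumping to `exit` unless all registers in a list are zero; `pc` is the position of the first
instruction. -/
def checkProgram (exit : ℕ) : ℕ → List ℕ → Program
  | _, [] => []
  | pc, c :: cs => .jz (.reg c) (pc + 2) :: .jz (.imm 0) exit :: checkProgram exit (pc + 2) cs

/-- Writing the generator `a` if no letter that does not commute with it has been flagged; `pc` is
the position of the first instruction. -/
noncomputable def generatorProgram (Γ : SimpleGraph (Fin N)) (pc : ℕ) (a : Fin N) : Program :=
  checkProgram (pc + 2 * (neighborCodes Γ a).length + 2) pc (neighborCodes Γ a) ++
    [.write (.imm (letterCode (a, true))), .write (.imm 1)]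

/-- Writing the generators in a list that commute with all flagged letters; `pc` is the position of
the first instruction. -/
noncomputable def centralProgram (Γ : SimpleGraph (Fin N)) : ℕ → List (Fin N) → Program
  | _, [] => [.write (.imm 0), .halt]
  | pc, a :: as => generatorProgram Γ pc a ++
      centralProgram Γ (pc + (generatorProgram Γ pc a).length) as

theorem length_checkProgram (exit pc : ℕ) (cs : List ℕ) :
    (checkProgram exit pc cs).length = 2 * cs.length := by
  induction cs generalizing pc with
  | nil => rfl
  | cons c cs ih =>
    rw [checkProgram, List.length_cons, List.length_cons, List.length_cons, ih]
    ring

theorem length_generatorProgram (pc : ℕ) (a : Fin N) :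
    (generatorProgram Γ pc a).length = 2 * (neighborCodes Γ a).length + 2 := by
  rw [generatorProgram, List.length_append, length_checkProgram]
  rfl

theorem check_run {exit pc : ℕ} {cs : List ℕ} (hP : CodeAt P pc (checkProgram exit pc cs))
    (hm : Bdd B m) :
    Reach P B (2 * cs.length) ⟨pc, m, i, o⟩
      ⟨if ∀ c ∈ cs, m c = 0 then pc + 2 * cs.length else exit, m, i, o⟩ := by
  induction cs generalizing pc with
  | nil => simpa using Reach.refl hm
  | cons c cs ih =>
    rw [checkProgram] at hP
    rw [List.length_cons, Nat.mul_succ]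
    by_cases hc : m c = 0
    · have h := Reach.jz (i := i) (o := o) hP.head hm (val_reg hc) rfl (ih hP.tail.tail)
      simpa [hc, Nat.add_assoc, Nat.add_comm 2] using h.mono (Nat.le_succ _)
    · have h : Reach P B 2 ⟨pc, m, i, o⟩ ⟨exit, m, i, o⟩ :=
        .jz_of_ne hP.head hm (val_reg rfl) hc (.jump hP.tail.head hm (.refl hm))
      simpa [hc] using h.mono (Nat.le_add_left 2 _)

theorem generator_run {pc : ℕ} {a : Fin N} (hP : CodeAt P pc (generatorProgram Γ pc a))
    (hm : Bdd B m) :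
    Reach P B (4 * N + 2) ⟨pc, m, i, o⟩ ⟨pc + (generatorProgram Γ pc a).length, m, i,
      o ++ if ∀ c ∈ neighborCodes Γ a, m c = 0 then [letterCode (a, true), 1] else []⟩ := by
  have hlen := length_neighborCodes_le (Γ := Γ) a
  have hcheck := check_run (i := i) (o := o) (CodeAt.append_left hP) hm
  rw [length_generatorProgram]
  split_ifs at hcheck ⊢ with ha
  · have hwrite := CodeAt.append_right hP
    rw [length_checkProgram] at hwrite
    rw [List.append_cons]
    exact (hcheck.trans (.write hwrite.head hm val_imm
      (.write hwrite.tail.head hm val_imm (.refl (T := 0) hm)))).mono (by omega)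
  · rw [List.append_nil]
    exact hcheck.mono (by omega)

theorem central_run {pc : ℕ} {as : List (Fin N)} (hP : CodeAt P pc (centralProgram Γ pc as))
    (hm : Bdd B m) :
    ∃ d, step P d = none ∧
      d.output = o ++ (as.filter fun a => ∀ c ∈ neighborCodes Γ a, m c = 0).flatMap
        (fun a => [letterCode (a, true), 1]) ++ [0] ∧
      Reach P B (as.length * (4 * N + 2) + 1) ⟨pc, m, i, o⟩ d := by
  induction as generalizing pc o with
  | nil =>
    rw [centralProgram] at hP
    refine ⟨⟨pc + 1, m, i, o ++ [0]⟩, ?_, by simp, ?_⟩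
    · rw [step, hP.tail.head]
      rfl
    · exact Reach.mono (T := 1) (.write hP.head hm val_imm (.refl hm)) (by omega)
  | cons a as ih =>
    rw [centralProgram] at hP
    obtain ⟨d, hd, hout, hR⟩ := ih (o := o ++
      if ∀ c ∈ neighborCodes Γ a, m c = 0 then [letterCode (a, true), 1] else [])
      hP.append_right
    refine ⟨d, hd, ?_, ((generator_run hP.append_left hm).trans hR).mono ?_⟩
    · rw [hout, List.filter_cons]
      simp only [decide_eq_true_eq]
      split_ifs <;> simp
    · rw [List.length_cons]
      linarith

open Classical in
/-- The generators that commute with all generators occurring in `w`. -/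
noncomputable def centralGenerators (Γ : SimpleGraph (Fin N)) (w : Word N) : List (Fin N) :=
  (List.finRange N).filter fun a => ∀ b ∈ support w, ¬ Γ.Adj a b

theorem mem_centralGenerators {w : Word N} {a : Fin N} :
    a ∈ centralGenerators Γ w ↔ ∀ b ∈ support w, ¬ Γ.Adj a b := by
  simp [centralGenerators]

theorem Flagged.neighborCodes_eq_zero_iff {w : Word N}
    (h : Flagged (2 * N + 2) (w.map letterCode) m) {a : Fin N} :
    (∀ c ∈ neighborCodes Γ a, m c = 0) ↔ ∀ b ∈ support w, ¬ Γ.Adj a b := by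
  have hflag (l : Fin N × Bool) : m (letterCode l) = 0 ↔ l ∉ w := by
    rw [h _ (two_le_letterCode l) (letterCode_lt l), List.mem_map_of_injective letterCode_injective]
  simp only [mem_neighborCodes, forall_exists_index, and_imp]
  constructor
  · rintro hzero b ⟨l, hl, rfl⟩ hab
    exact (hflag l).1 (hzero _ l hab rfl) hl
  · rintro hadj _ l hal rfl
    exact (hflag l).2 fun hl => hadj l.1 ⟨l, hl, rfl⟩ hal

/-- The roots of the words `ws`, and the generators that commute with all generators occurring in
`ws`. -/
noncomputable def canonicalGenerators (Γ : SimpleGraph (Fin N)) (ws : List (Word N)) :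
    List (Word N) :=
  ws.map root ++ (centralGenerators Γ ws.flatten).map fun a => [(a, true)]

/-- The program that computes the canonical generating set of the centralizer. -/
noncomputable def centralizerProgram (Γ : SimpleGraph (Fin N)) : Program :=
  rootProgram (2 * N + 2) ++ centralProgram Γ 43 (List.finRange N)

theorem codeAt_centralProgram :
    CodeAt (centralizerProgram Γ) 43 (centralProgram Γ 43 (List.finRange N)) := by
  have h : CodeAt (centralizerProgram Γ) 0 (centralizerProgram Γ) := fun j I hj => by
    rwa [Nat.zero_add]
  exact Nat.zero_add 43 ▸ h.append_right

theorem centralizerProgram_computesWithin (Γ : SimpleGraph (Fin N)) {ws : List (Word N)}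
    (hne : ∀ w ∈ ws, w ≠ []) {T : ℕ} (hT : 70 * ws.flatten.length + N * (4 * N + 2) + 3 ≤ T)
    (hB : 2 * N + 2 * ws.flatten.length + 22 ≤ B) :
    ComputesWithin (centralizerProgram Γ) (encode ws) (encode (canonicalGenerators Γ ws)) T B := by
  obtain ⟨m, hL, hR⟩ := words_loop (L := []) (o := []) (B := B) (m := fun _ => 0)
    (codeAt_append_zero _ (centralProgram Γ 43 (List.finRange N))) hne
    (fun w hw => by
      have := (List.sublist_flatten_of_mem hw).length_le
      omega) (fun _ => Nat.zero_le _) (fun c _ _ => by simp)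
  rw [List.nil_append] at hL
  obtain ⟨d, hd, hout, hR'⟩ := central_run (i := []) (Γ := Γ)
    (o := [] ++ ws.flatMap fun w => (root w).map letterCode ++ [1]) codeAt_centralProgram hR.bdd
  have hcentral : (List.finRange N).filter (fun a => ∀ c ∈ neighborCodes Γ a, m c = 0) =
      centralGenerators Γ ws.flatten :=
    List.filter_congr fun a _ => by
      rw [decide_eq_decide]
      exact hL.neighborCodes_eq_zero_iff
  have hencode : encode (canonicalGenerators Γ ws) = d.output := by
    rw [hout, hcentral]
    simp [canonicalGenerators, encode, List.flatMap_map]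
  rw [hencode]
  refine ((hR.trans hR').mono ?_).computesWithin hd
  rw [List.length_finRange]
  omega

theorem isCanonicalGeneratingList_canonicalGenerators {ws : List (Word N)}
    (hnormal : ∀ w ∈ ws, CyclicNormalForm Γ w) (hne : ∀ w ∈ ws, w ≠ []) :
    IsCanonicalGeneratingList Γ ws (canonicalGenerators Γ ws) := by
  refine ⟨ws.map root, centralGenerators Γ ws.flatten, rfl, ?_,
    (List.nodup_finRange N).filter _, fun a => ?_⟩
  · rw [List.forall₂_map_right_iff, List.forall₂_same]
    exact fun w hw => isMinimalRoot_of_isWordRoot (hnormal w hw) (isWordRoot_root (hne w hw))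
  · rw [mem_centralGenerators]
    exact forall₂_congr fun b _ => gen_commute_iff.symm

theorem closure_canonicalGenerators {ws : List (Word N)}
    (hred : CyclicallyReduced Γ ws.flatten) (hnormal : ∀ w ∈ ws, CyclicNormalForm Γ w)
    (hne : ∀ w ∈ ws, w ≠ []) (hsep : ws.Pairwise (Separated Γ)) :
    Subgroup.closure {g | ∃ v ∈ canonicalGenerators Γ ws, g = elt Γ v} =
      Subgroup.centralizer {elt Γ ws.flatten} :=
  closure_eq_centralizer hred hnormal hsep (fun w hw => isWordRoot_root (hne w hw))
    fun _ => mem_centralGenerators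

end RAAG

/-- For every right-angled Artin group there are a RAM program and a constant, depending only on
the group, such that on every word decomposed into non-split cyclic normal forms the program runs
in linear time, with registers of linear size (hence logarithmic bit length), and outputs the
canonical generating set of the centralizer of the word. -/
theorem propositionP {N : ℕ} (Γ : SimpleGraph (Fin N)) :
    ∃ (P : RAM.Program) (C : ℕ), ∀ ws : List (RAAG.Word N), RAAG.IsNonSplitDecomposition Γ ws →
      ∃ out : List (RAAG.Word N),
        RAM.ComputesWithin P (RAAG.encode ws) (RAAG.encode out)
          (C * (ws.flatten.length + 1)) (C * (ws.flatten.length + 1)) ∧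
        RAAG.IsCanonicalGeneratingList Γ ws out ∧
        Subgroup.closure {g | ∃ v ∈ out, g = RAAG.elt Γ v} =
          Subgroup.centralizer {RAAG.elt Γ ws.flatten} := by
  refine ⟨RAAG.centralizerProgram Γ, 100 + 2 * N + N * (4 * N + 2), fun ws h => ?_⟩
  have hne : ∀ w ∈ ws, w ≠ [] := fun w hw => (h.nonSplit w hw).1
  exact ⟨RAAG.canonicalGenerators Γ ws,
    RAAG.centralizerProgram_computesWithin Γ hne
      (by nlinarith [Nat.zero_le (N * (4 * N + 2) * ws.flatten.length)])
      (by nlinarith [Nat.zero_le (N * (4 * N + 2) * ws.flatten.length)]),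
    RAAG.isCanonicalGeneratingList_canonicalGenerators h.cyclicNormalForm hne,
    RAAG.closure_canonicalGenerators h.cyclicallyReduced h.cyclicNormalForm hne h.separated⟩
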